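/- \textbf{Setting.} There are $U\ge 1$ queues and $K\ge 2$ servers in discrete time $t=1,2,\dots$. Arrivals $A_u(t)\sim\mathrm{Bernoulli}(\lambda_u)$ and offered services $R_{uk}(t)\sim\mathrm{Bernoulli}(\mu_{uk})$ ($u\in[U]$, $k\in[K]$, $t\ge1$) are all independent. A matching is an injective map $\kappa:[U]\to[K]$. Assume that every queue $u$ has a unique best server $k^*_u=\arg\max_k\mu_{uk}$, that $k^*_u\ne k^*_{u'}$ for $u\neq u'$, and that $\epsilon_u:=\mu^*_u-\lambda_u>0$ for all $u$, where $\mu_u^*:=\mu_{uk^*_u}$. Let $\Delta:=\min_{u,\,k\ne k^*_u}(\mu^*_u-\mu_{uk})>0$. \textbf{Algorithm Q-ThS(match).} Fix a set $\mathcal E$ of $K$ matchings that covers all pairs $(u,k)$. At time $t$ let $T_{uk}(t-1)$ be the number of earlier slots in which $k$ was assigned to $u$, and $\hat\mu_{uk}(t)$ the empirical mean of the services observed in these slots. With probability $\min\{1,3K\log^2 t/t\}$, independently of everything else, \emph{explore}: schedule a matching $\kappa(t)$ drawn uniformly from $\mathcal E$. Otherwise \emph{exploit}: draw independent samples $\hat\theta_{uk}(t)\sim\mathrm{Beta}\big(\hat\mu_{uk}(t)T_{uk}(t-1)+1,\,(1-\hat\mu_{uk}(t))T_{uk}(t-1)+1\big)$,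 put $\hat k_u(t)=\arg\max_k\hat\theta_{uk}(t)$ (ties, which have probability $0$, going to the smallest index), and schedule a matching $\kappa(t)$ that minimizes the Hamming distance $\#\{u:\kappa_u\ne\hat k_u(t)\}$ over all matchings (ties broken by any fixed rule, which may depend on the past matchings and observed services). For $U=1$ this is the algorithm Q-ThS: explore a uniformly random server, otherwise schedule $\arg\max_k\hat\theta_k(t)$. \textbf{Queues and regret.} $Q_u(t)=(Q_u(t-1)+A_u(t)-R_{u\kappa_u(t)}(t))^+$ and $Q^*_u(t)=(Q^*_u(t-1)+A_u(t)-R_{uk^*_u}(t))^+$. The initial lengths are independent of all other randomness, and for each $u$ both $Q_u(0)$ and $Q^*_u(0)$ have the stationary distribution of the chain $Q^*_u$. The queue-regret is $\Psi_u(t)=\mathbb E[Q_u(t)-Q^*_u(t)]$. \textbf{Theorem.} For every $\Delta>0$ there are constants $C$ and $t_0$ depending only on $\Delta$ (in particular not on $U$, $K$, the $\epsilon_u$, or the rates otherwise) such that the following holds for every system as above with minimal gap $\Delta$. Let $$w(t)=\exp\Big(\Big(\tfrac{2\log t}{\Delta}\Big)^{2/3}\Big),\quad v'_u(t)=\frac{6K}{\epsilon_u}w(t),\quad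 v_u(t)=\frac{24}{\epsilon_u^2}\log t+\frac{60K}{\epsilon_u}\,\frac{v'_u(t)\log^2t}{t}.$$ Then for every queue $u$ and every integer $t>t_0$ with $\frac{w(t)}{\log t}\ge\frac2{\epsilon_u}$, $t\ge\exp(6/\Delta^2)$ and $v_u(t)+v'_u(t)\le t/2$, the variables $Q_u(t)$ and $Q_u^*(t)$ are integrable and $$\Psi_u(t)\le C\,\frac{K\,v_u(t)\log^2t}{t}.$$ The case $U=1$ is the statement for a single queue and $K$ servers under Q-ThS. -/

import Mathlib

open MeasureTheory ProbabilityTheory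

namespace QueueingBandit

noncomputable section

/-! ### Problem instances -/

/-- A problem instance with `U` queues and `K` servers: Bernoulli arrival rates `lam u`, Bernoulli
service rates `mu u k`, a unique optimal matching `best` (an injective map, so distinct queues have
distinct optimal servers), and stability of every queue under the optimal matching. -/
structure Instance (U K : ℕ) where
  lam : Fin U → unitInterval
  mu : Fin U → Fin K → unitInterval
  best : Fin U ↪ Fin K
  best_unique : ∀ u k, k ≠ best u → mu u k < mu u (best u)
  stable : ∀ u, lam u < mu u (best u)

namespace Instance

variable {U K : ℕ} (I : Instance U K)

/-- The rate of the best server of queue `u`. -/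
def muStar (u : Fin U) : unitInterval := I.mu u (I.best u)

/-- `ε_u = μ*_u - λ_u`. -/
def eps (u : Fin U) : ℝ := (I.muStar u : ℝ) - I.lam u

/-- `Δ`, the minimum of `μ*_u - μ_{uk}` over all queues `u` and all servers `k` other than the best
server of `u` (a minimum over a finite set, nonempty when `1 ≤ U` and `2 ≤ K`). -/
def gap : ℝ :=
  ⨅ p : {p : Fin U × Fin K // p.2 ≠ I.best p.1}, ((I.muStar p.1.1 : ℝ) - I.mu p.1.1 p.1.2)

end Instance

/-! ### Matchings, observations and histories -/

/-- A matching assigns to every queue a server, different queues getting different servers. -/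
abbrev Matching (U K : ℕ) : Type := Fin U ↪ Fin K

instance (U K : ℕ) : MeasurableSpace (Matching U K) := ⊤

/-- The scheduled matchings together with the services they offered to the queues (`true` is a
success), the most recent time slot first. -/
abbrev History (U K : ℕ) : Type := List (Matching U K × (Fin U → Bool))

/-- The number of past time slots in which server `k` was assigned to queue `u` and offered the
service `b`. -/
def History.count {U K : ℕ} (h : History U K) (u : Fin U) (k : Fin K) (b : Bool) : ℕ :=
  h.countP fun o => decide (o.1 u = k ∧ o.2 u = b)

/-! ### Randomness -/

/-- Index set of the independent sources of randomness. -/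
inductive Source (U K : ℕ) : Type
  /-- the pairs of initial queue lengths `(Q_u(0), Q*_u(0))`, for all queues `u` jointly -/
  | init
  /-- `A_u(t)` -/
  | arrival (t : ℕ) (u : Fin U)
  /-- `R_{uk}(t)` -/
  | service (t : ℕ) (u : Fin U) (k : Fin K)
  /-- `E(t)`, the indicator of exploration -/
  | explore (t : ℕ)
  /-- the matching scheduled at time `t` in case of exploration -/
  | exploreMatching (t : ℕ)
  /-- the sample drawn at time `t` for the link `(u, k)` in case the past assignments of server `k`
  to queue `u` have had `s` successes and `f` failures -/
  | sample (t : ℕ) (u : Fin U) (k : Fin K) (s f : ℕ)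

/-- The values taken by each source of randomness. -/
def Source.Val {U K : ℕ} : Source U K → Type
  | .init => Fin U → ℕ × ℕ
  | .arrival _ _ => Bool
  | .service _ _ _ => Bool
  | .explore _ => Bool
  | .exploreMatching _ => Matching U K
  | .sample _ _ _ _ _ => ℝ

instance Source.instMeasurableSpaceVal {U K : ℕ} : (i : Source U K) → MeasurableSpace i.Val
  | .init => inferInstanceAs (MeasurableSpace (Fin U → ℕ × ℕ))
  | .arrival _ _ => inferInstanceAs (MeasurableSpace Bool)
  | .service _ _ _ => inferInstanceAs (MeasurableSpace Bool)
  | .explore _ => inferInstanceAs (MeasurableSpace Bool)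
  | .exploreMatching _ => inferInstanceAs (MeasurableSpace (Matching U K))
  | .sample _ _ _ _ _ => inferInstanceAs (MeasurableSpace ℝ)

/-- The Bernoulli distribution with mean `p` on `Bool`. -/
def bernoulliLaw (p : unitInterval) : Measure Bool := bernoulliMeasure true false p

/-- The exploration probability `min {1, 3 K log² t / t}`. -/
def exploreProb (K t : ℕ) : unitInterval :=
  ⟨min 1 (3 * K * Real.log t ^ 2 / t), le_min zero_le_one (by positivity), min_le_left _ _⟩

/-- The law of each source of randomness: `ν` is the joint law of the initial queue lengths and
`𝓔` is the set of matchings used for exploration. -/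
def Source.law {U K : ℕ} (I : Instance U K) (𝓔 : Finset (Matching U K))
    (ν : Measure (Fin U → ℕ × ℕ)) : (i : Source U K) → Measure i.Val
  | .init => ν
  | .arrival _ u => bernoulliLaw (I.lam u)
  | .service _ u k => bernoulliLaw (I.mu u k)
  | .explore t => bernoulliLaw (exploreProb K t)
  | .exploreMatching _ => uniformOn (𝓔 : Set (Matching U K))
  | .sample _ _ _ s f => betaMeasure (s + 1) (f + 1)

/-! ### The algorithm Q-ThS(match) -/

/-- The exploration set consists of `K` matchings that cover all links between queues and servers.
For one queue it consists of all the servers. -/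
def IsExploreSet {U K : ℕ} (𝓔 : Finset (Matching U K)) : Prop :=
  𝓔.card = K ∧ ∀ u k, ∃ m ∈ 𝓔, m u = k

/-- `proj` projects vectors of servers onto the set of matchings with respect to the Hamming
distance; ties are broken in any way that may depend on the past. -/
def IsProjection {U K : ℕ} (proj : History U K → (Fin U → Fin K) → Matching U K) : Prop :=
  ∀ h x (m : Matching U K), hammingDist (proj h x : Fin U → Fin K) x ≤ hammingDist (m : Fin U → Fin K) x

/-- The (first) maximizer of a function on `Fin K`. -/
def argmax {K : ℕ} [NeZero K] (θ : Fin K → ℝ) : Fin K :=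
  (Finset.univ.filter fun k => ∀ j, θ j ≤ θ k).min' (by
    obtain ⟨k, hk⟩ := Finite.exists_max θ
    exact ⟨k, by simpa using hk⟩)

section

variable {U K : ℕ} [NeZero K] {Ω : Type*}
  (proj : History U K → (Fin U → Fin K) → Matching U K) (X : (i : Source U K) → Ω → i.Val)

/-- The posterior sample `θ̂_{uk}(t)` given the past `h`. In the notation `T` for the number of past
assignments of `k` to `u` and `μ̂` for the empirical mean of the services, the number of successes is
`μ̂ T` and the number of failures is `(1 - μ̂) T`, so that the sample has the distribution
`Beta(μ̂ T + 1, (1 - μ̂) T + 1)`. -/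
def thetaHat (t : ℕ) (h : History U K) (ω : Ω) (u : Fin U) (k : Fin K) : ℝ :=
  X (.sample t u k (h.count u k true) (h.count u k false)) ω

/-- The matching scheduled by the algorithm at time `t` given the past `h`. -/
def schedule (t : ℕ) (h : History U K) (ω : Ω) : Matching U K :=
  let explore : Bool := X (.explore t) ω
  if explore then X (.exploreMatching t) ω
  else proj h fun u => argmax (thetaHat X t h ω u)

/-- The history of the time slots `1, …, t` under the algorithm. -/
def history : ℕ → Ω → History U K
  | 0, _ => []
  | t + 1, ω =>
    let h := history t ω
    let m := schedule proj X (t + 1) h ω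
    (m, fun u => X (.service (t + 1) u (m u)) ω) :: h

/-- `κ(t)`, the matching scheduled at time `t ≥ 1`. -/
def kappa (t : ℕ) (ω : Ω) : Matching U K := schedule proj X t (history proj X (t - 1) ω) ω

/-- One step `q ↦ (q + a - s)⁺` of a queue (the subtraction of natural numbers is truncated at
`0`). -/
def step (q : ℕ) (a s : Bool) : ℕ := q + a.toNat - s.toNat

/-- `Q_u(t)`, the length of queue `u` under the algorithm. -/
def queue (u : Fin U) : ℕ → Ω → ℕ
  | 0, ω =>
    let q : Fin U → ℕ × ℕ := X .init ω
    (q u).1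
  | t + 1, ω =>
    step (queue u t ω) (X (.arrival (t + 1) u) ω)
      (X (.service (t + 1) u (kappa proj X (t + 1) ω u)) ω)

/-- `Q*_u(t)`, the length of queue `u` under the optimal matching. -/
def queueStar {U K : ℕ} {Ω : Type*} (I : Instance U K) (X : (i : Source U K) → Ω → i.Val)
    (u : Fin U) : ℕ → Ω → ℕ
  | 0, ω =>
    let q : Fin U → ℕ × ℕ := X .init ω
    (q u).2
  | t + 1, ω =>
    step (queueStar I X u t ω) (X (.arrival (t + 1) u) ω) (X (.service (t + 1) u (I.best u)) ω)

/-- The queue-regret `Ψ_u(t) = E[Q_u(t) - Q*_u(t)]`. -/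
def regret [MeasurableSpace Ω] (P : Measure Ω) (I : Instance U K) (u : Fin U) (t : ℕ) : ℝ :=
  ∫ ω, ((queue proj X u t ω : ℝ) - (queueStar I X u t ω : ℝ)) ∂P

end

/-- `π` is a stationary distribution of the queue `Q ↦ (Q + A - S)⁺` with independent Bernoulli
arrivals of mean `p` and Bernoulli services of mean `r`. -/
def IsStationary (p r : unitInterval) (π : Measure ℕ) : Prop :=
  IsProbabilityMeasure π ∧
    (π.prod ((bernoulliLaw p).prod (bernoulliLaw r))).map (fun x => step x.1 x.2.1 x.2.2) = π

/-- `ν`, the joint law of all `(Q_u(0), Q*_u(0))`, is such that for every `u` both `Q_u(0)` and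
`Q*_u(0)` have the stationary distribution of `Q*_u`. -/
def IsInitialLaw {U K : ℕ} (I : Instance U K) (ν : Measure (Fin U → ℕ × ℕ)) : Prop :=
  ∀ u, ∃ π : Measure ℕ, IsStationary (I.lam u) (I.muStar u) π ∧
    ν.map (fun q => (q u).1) = π ∧ ν.map (fun q => (q u).2) = π

/-- The random variables `X` are independent and have the prescribed laws. -/
structure IsModel {U K : ℕ} (I : Instance U K) (𝓔 : Finset (Matching U K))
    (ν : Measure (Fin U → ℕ × ℕ)) {Ω : Type*} [MeasurableSpace Ω] (P : Measure Ω)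
    (X : (i : Source U K) → Ω → i.Val) : Prop where
  indep : iIndepFun X P
  law : ∀ i, HasLaw (X i) (i.law I 𝓔 ν) P

/-! ### The functions in the bound -/

/-- `w(t) = exp ((2 log t / Δ)^(2/3))`. -/
def w (Δ t : ℝ) : ℝ := Real.exp ((2 * Real.log t / Δ) ^ (2 / 3 : ℝ))

/-- `v'(t) = (6 K / ε) w(t)`. -/
def v' (K Δ ε t : ℝ) : ℝ := 6 * K / ε * w Δ t

/-- `v(t) = (24 / ε²) log t + (60 K / ε) v'(t) log² t / t`. -/
def v (K Δ ε t : ℝ) : ℝ :=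
  24 / ε ^ 2 * Real.log t + 60 * K / ε * (v' K Δ ε t * Real.log t ^ 2 / t)

end

end QueueingBandit

/-!
The queue of `u` under the algorithm is compared with the queue `optimalQueue` that has the same
initial length, the same arrivals and the services of the best server. The latter is stationary, so
its mean at time `t` is that of `queueStar` (`lintegral_optimalQueue`), and the regret is the mean
difference of the two. Their paths differ by at most the number of slots in which the schedule does
not use the best server, and these only count from the last time at which the queue was empty
(`path_le_add_sum`). Write `ε` for `I.eps u`.

* *Exploitation is right after time `w Δ t`.* Until then every link has been explored about
  `log² w` times in the mean. The observed service is independent of the schedule and of the past, so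
  the mean of `x ^ successes * y ^ failures` contracts in every slot in proportion to the exploration
  probability (`lintegral_pow_count_le`). Integrating an exponential bound on the tails of the Beta
  distribution (`betaMeasure_tail_le`) over the numbers of successes and failures bounds the
  probability that a posterior sample is off by `Δ / 2` by `exp (-c * log² w)` up to constants, which
  is below any power of `t`: this is what the exponent `2 / 3` in `w` achieves
  (`measure_thetaHat_le`, `measure_wrongExploit_le`). When all samples are within `Δ / 2` of their
  rates, their maximizers form the best matching, which the projection leaves unchanged.

* *The queue was empty at some time in the last `24 / ε² * log t` slots.* Otherwise the busy period at
  time `t` began at some earlier time `σ` (or at the start), and the arrivals since `σ` exceed the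
  services (`exists_empty_or_sum_pos`). Charging one unit to every exploration and to every slot
  before `w`, this event concerns a sum of independent variables of mean about `-ε`, and
  Markov's inequality for the exponential of order `ε / 4` applies (`measure_sum_pos_le`). The initial
  length has such a moment, because the balance equation across the cuts makes the stationary
  distribution decay geometrically (`IsStationary.cut`). The hypotheses on `t` say that the
  costs are small compared to the drift (`measure_longBusy_le`).

Outside these events of total probability `O(t⁻²)`, on which the difference is at most `t`, only the
explorations of the last `24 / ε² * log t` slots count (`lintegral_queue_le`). Each has probability at
most `6 * K * log² t / t`, which gives the bound with `C = 8`.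
-/

namespace QueueingBandit

open Set Filter
open scoped ENNReal

/-! ### The sources of randomness -/

section Sources

variable {U K : ℕ}

/-- The time slot to which a source of randomness belongs; the initial queue lengths get slot `0`. -/
def Source.time : Source U K → ℕ
  | .init => 0
  | .arrival t _ => t
  | .service t _ _ => t
  | .explore t => t
  | .exploreMatching t => t
  | .sample t _ _ _ _ => t

instance : Countable (Source U K) := by
  let f : Source U K → ℕ × ℕ × ℕ × ℕ × ℕ × ℕ
    | .init => (0, 0, 0, 0, 0, 0)
    | .arrival t u => (1, t, u, 0, 0, 0)
    | .service t u k => (2, t, u, k, 0, 0)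
    | .explore t => (3, t, 0, 0, 0, 0)
    | .exploreMatching t => (4, t, 0, 0, 0, 0)
    | .sample t u k s f => (5, t, u, k, s, f)
  have hf : Function.Injective f := by
    rintro (_ | _ | _ | _ | _ | _) (_ | _ | _ | _ | _ | _) h <;>
      simp_all [f, Fin.ext_iff]
  exact hf.countable

variable {Ω : Type*}

/-- The arrival `A_u(t)`. -/
abbrev arrivalVar (X : (i : Source U K) → Ω → i.Val) (t : ℕ) (u : Fin U) : Ω → Bool :=
  X (.arrival t u)

/-- The offered service `R_{uk}(t)`. -/
abbrev serviceVar (X : (i : Source U K) → Ω → i.Val) (t : ℕ) (u : Fin U) (k : Fin K) : Ω → Bool :=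
  X (.service t u k)

/-- The indicator of exploration in slot `t`. -/
abbrev exploreVar (X : (i : Source U K) → Ω → i.Val) (t : ℕ) : Ω → Bool :=
  X (.explore t)

/-- The matching scheduled in slot `t` in case of exploration. -/
abbrev exploreMatchingVar (X : (i : Source U K) → Ω → i.Val) (t : ℕ) : Ω → Matching U K :=
  X (.exploreMatching t)

/-- The initial queue lengths. -/
abbrev initVar (X : (i : Source U K) → Ω → i.Val) : Ω → Fin U → ℕ × ℕ :=
  X .init

/-- The σ-algebra generated by the sources of randomness in the set `S`. -/
abbrev sourceSigma (X : (i : Source U K) → Ω → i.Val) (S : Set (Source U K)) : MeasurableSpace Ω :=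
  ⨆ i ∈ S, MeasurableSpace.comap (X i) inferInstance

variable {X : (i : Source U K) → Ω → i.Val}

lemma measurable_sourceSigma {S : Set (Source U K)} {i : Source U K} (hi : i ∈ S) :
    Measurable[sourceSigma X S] (X i) :=
  (comap_measurable (X i)).mono (le_iSup₂_of_le i hi le_rfl) le_rfl

lemma sourceSigma_le [mΩ : MeasurableSpace Ω] (hX : ∀ i, Measurable (X i)) (S : Set (Source U K)) :
    sourceSigma X S ≤ mΩ :=
  iSup₂_le fun i _ => (hX i).comap_le

lemma indep_sourceSigma [MeasurableSpace Ω] {P : Measure Ω} (hX : ∀ i, Measurable (X i))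
    (hind : iIndepFun X P) {S T : Set (Source U K)} (hST : Disjoint S T) :
    Indep (sourceSigma X S) (sourceSigma X T) P :=
  indep_iSup_of_disjoint (fun i => (hX i).comap_le) hind hST

lemma lintegral_mul_of_sourceSigma [MeasurableSpace Ω] {P : Measure Ω}
    (hX : ∀ i, Measurable (X i)) (hind : iIndepFun X P) {S T : Set (Source U K)}
    (hST : Disjoint S T) {f g : Ω → ℝ≥0∞} (hf : Measurable[sourceSigma X S] f)
    (hg : Measurable[sourceSigma X T] g) :
    ∫⁻ ω, f ω * g ω ∂P = (∫⁻ ω, f ω ∂P) * ∫⁻ ω, g ω ∂P :=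
  lintegral_mul_eq_lintegral_mul_lintegral_of_independent_measurableSpace
    (sourceSigma_le hX S) (sourceSigma_le hX T) (indep_sourceSigma hX hind hST) hf hg

lemma lintegral_bernoulliLaw (p : unitInterval) (f : Bool → ℝ≥0∞) :
    ∫⁻ b, f b ∂bernoulliLaw p =
      ENNReal.ofReal p * f true + ENNReal.ofReal (1 - p) * f false := by
  rw [bernoulliLaw, bernoulliMeasure_def, lintegral_add_measure, lintegral_smul_measure,
    lintegral_smul_measure, lintegral_dirac, lintegral_dirac]
  congr 2
  · exact NNReal.eq (by simp [Real.coe_toNNReal _ p.2.1])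
  · exact NNReal.eq (by simp [Real.coe_toNNReal _ (sub_nonneg.2 p.2.2)])

instance (p : unitInterval) : IsProbabilityMeasure (bernoulliLaw p) := by
  unfold bernoulliLaw; infer_instance

namespace IsModel

variable {I : Instance U K} {𝓔 : Finset (Matching U K)} {ν : Measure (Fin U → ℕ × ℕ)}
  [MeasurableSpace Ω] {P : Measure Ω}

lemma hasLaw_arrival (hM : IsModel I 𝓔 ν P X) (t : ℕ) (u : Fin U) :
    HasLaw (arrivalVar X t u) (bernoulliLaw (I.lam u)) P :=
  hM.law (.arrival t u)

lemma hasLaw_service (hM : IsModel I 𝓔 ν P X) (t : ℕ) (u : Fin U) (k : Fin K) :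
    HasLaw (serviceVar X t u k) (bernoulliLaw (I.mu u k)) P :=
  hM.law (.service t u k)

lemma hasLaw_explore (hM : IsModel I 𝓔 ν P X) (t : ℕ) :
    HasLaw (exploreVar X t) (bernoulliLaw (exploreProb K t)) P :=
  hM.law (.explore t)

lemma hasLaw_exploreMatching (hM : IsModel I 𝓔 ν P X) (t : ℕ) :
    HasLaw (exploreMatchingVar X t) (uniformOn (𝓔 : Set (Matching U K))) P :=
  hM.law (.exploreMatching t)

lemma measure_explore_eq_true (hM : IsModel I 𝓔 ν P X) (t : ℕ) :
    P {ω | exploreVar X t ω = true} = ENNReal.ofReal (exploreProb K t) := by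
  rw [(hM.hasLaw_explore t).measure_eq (p := fun b => b = true) .of_discrete,
    ← lintegral_indicator_one .of_discrete, lintegral_bernoulliLaw]
  simp

end IsModel

end Sources

/-! ### Measurability of the algorithm -/

section Measurability

variable {U K : ℕ}

instance : MeasurableSpace (History U K) := ⊤

lemma measurable_comp_countable {Ω α β : Type*} [MeasurableSpace Ω] [MeasurableSpace α]
    [MeasurableSpace β] [Countable α] [MeasurableSingletonClass α] {f : α → Ω → β} {h : Ω → α}
    (hf : ∀ a, Measurable (f a)) (hh : Measurable h) : Measurable fun ω => f (h ω) ω := by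
  intro s hs
  have : (fun ω => f (h ω) ω) ⁻¹' s = ⋃ a, h ⁻¹' {a} ∩ f a ⁻¹' s := by
    ext ω; simp
  rw [this]
  exact .iUnion fun a => (hh (measurableSet_singleton a)).inter (hf a hs)

variable [NeZero K]

lemma le_argmax (θ : Fin K → ℝ) (j : Fin K) : θ j ≤ θ (argmax θ) := by
  have := Finset.min'_mem (Finset.univ.filter fun k => ∀ j, θ j ≤ θ k) (by
    obtain ⟨k, hk⟩ := Finite.exists_max θ
    exact ⟨k, by simpa using hk⟩)
  simp only [Finset.mem_filter, Finset.mem_univ, true_and] at this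
  exact this j

lemma argmax_eq_of_forall_lt {θ : Fin K → ℝ} {k : Fin K} (h : ∀ j, j ≠ k → θ j < θ k) :
    argmax θ = k := by
  by_contra hne
  exact absurd (le_argmax θ k) (not_le.2 (h _ hne))

lemma argmax_eq_iff {θ : Fin K → ℝ} {k : Fin K} :
    argmax θ = k ↔ (∀ j, θ j ≤ θ k) ∧ ∀ i, i < k → ∃ j, θ i < θ j := by
  constructor
  · rintro rfl
    refine ⟨le_argmax θ, fun i hi => ?_⟩
    by_contra! hcon
    exact absurd (Finset.min'_le (Finset.univ.filter fun k => ∀ j, θ j ≤ θ k) i (by simpa using hcon))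
      (not_le.2 hi)
  · rintro ⟨h1, h2⟩
    refine le_antisymm (Finset.min'_le _ _ (by simpa using h1)) ?_
    by_contra! hlt
    obtain ⟨j, hj⟩ := h2 _ hlt
    exact absurd (le_argmax θ j) (not_le.2 hj)

lemma measurable_argmax : Measurable (argmax : (Fin K → ℝ) → Fin K) := by
  refine measurable_to_countable' fun k => ?_
  have : (argmax ⁻¹' {k} : Set (Fin K → ℝ)) =
      (⋂ j, {θ | θ j ≤ θ k}) ∩ ⋂ i, ⋂ (_ : i < k), ⋃ j, {θ | θ i < θ j} := by
    ext θ
    simp [argmax_eq_iff]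
  rw [this]
  refine .inter (.iInter fun j => measurableSet_le (by fun_prop) (by fun_prop))
    (.iInter fun i => .iInter fun _ => .iUnion fun j => measurableSet_lt (by fun_prop) (by fun_prop))

variable {Ω : Type*} {proj : History U K → (Fin U → Fin K) → Matching U K}
  {X : (i : Source U K) → Ω → i.Val}

lemma schedule_of_explore {t : ℕ} {ω : Ω} (h : History U K) (hE : exploreVar X t ω = true) :
    schedule proj X t h ω = exploreMatchingVar X t ω :=
  if_pos hE

lemma schedule_of_not_explore {t : ℕ} {ω : Ω} (h : History U K) (hE : exploreVar X t ω = false) :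
    schedule proj X t h ω = proj h fun u => argmax (thetaHat X t h ω u) :=
  if_neg (by simp [hE])

lemma measurable_schedule [MeasurableSpace Ω] {t : ℕ}
    (hX : ∀ i : Source U K, i.time = t → (∀ u k, i ≠ .service t u k) → Measurable (X i))
    {h : Ω → History U K} (hh : Measurable h) :
    Measurable fun ω => schedule proj X t (h ω) ω := by
  refine measurable_comp_countable (f := fun a ω => schedule proj X t a ω) (fun a => ?_) hh
  have h1 : Measurable (fun ω => (X (.explore t) ω : Bool)) := hX (.explore t) rfl (by simp)
  have h2 : Measurable (fun ω => (X (.exploreMatching t) ω : Matching U K)) :=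
    hX (.exploreMatching t) rfl (by simp)
  refine Measurable.ite (h1 (measurableSet_singleton true)) h2 ?_
  refine (measurable_of_countable (proj a)).comp (measurable_pi_lambda _ fun u => ?_)
  refine measurable_argmax.comp (measurable_pi_lambda _ fun k => ?_)
  exact hX (.sample t u k _ _) rfl (by simp)

lemma measurable_history [MeasurableSpace Ω] {t : ℕ}
    (hX : ∀ i : Source U K, i.time ≤ t → Measurable (X i)) :
    Measurable (history proj X t) := by
  induction t with
  | zero => exact measurable_const
  | succ t ih =>
    have ih := ih fun i hi => hX i (by omega)
    refine measurable_comp_countable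
      (f := fun (p : History U K × Matching U K) ω =>
        (((p.2, fun u => X (.service (t + 1) u (p.2 u)) ω) :: p.1 : History U K))) (fun p => ?_)
      (ih.prodMk (measurable_schedule (proj := proj) (fun i hi _ => hX i hi.le) ih))
    refine (measurable_of_countable fun r : Fin U → Bool => ((p.2, r) :: p.1 : History U K)).comp
      (measurable_pi_lambda _ fun u => ?_)
    exact hX (.service (t + 1) u (p.2 u)) le_rfl

lemma measurable_kappa [MeasurableSpace Ω] {t : ℕ}
    (hX : ∀ i : Source U K, i.time ≤ t + 1 → (∀ u k, i ≠ .service (t + 1) u k) →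
      Measurable (X i)) :
    Measurable (kappa proj X (t + 1)) :=
  measurable_schedule (fun i hi h => hX i hi.le h)
    (measurable_history fun i hi => hX i (by simp at hi; omega) fun u k h => by
      subst h; simp [Source.time] at hi)

end Measurability

/-! ### Tails of the posterior -/

section Beta

lemma exp_le_one_add_add_sq {x : ℝ} (hx : |x| ≤ 1) : Real.exp x ≤ 1 + x + x ^ 2 := by
  have := (abs_le.1 (Real.abs_exp_sub_one_sub_id_le hx)).2
  linarith

/-- The moment generating function of a Bernoulli variable. -/
lemma one_add_mul_exp_le {p l : ℝ} (hp0 : 0 ≤ p) (hp1 : p ≤ 1) (hl : |l| ≤ 1) :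
    1 - p + p * Real.exp l ≤ Real.exp (l * p + l ^ 2) := by
  have h1 := exp_le_one_add_add_sq hl
  have h2 := Real.add_one_le_exp (l * p + l ^ 2)
  nlinarith [sq_nonneg l]

/-- The left-hand side is one term of the binomial expansion of `(1 - z + z * exp l) ^ (a + b)`, up to
the factor `exp (l * a)`. -/
lemma choose_mul_pow_le (a b : ℕ) {z : ℝ} (hz0 : 0 ≤ z) (hz1 : z ≤ 1) (l : ℝ) :
    ((a + b).choose a : ℝ) * z ^ a * (1 - z) ^ b ≤
      Real.exp (-(l * a)) * (1 - z + z * Real.exp l) ^ (a + b) := by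
  have h := add_pow (z * Real.exp l) (1 - z) (a + b)
  have h1 : (z * Real.exp l) ^ a * (1 - z) ^ (a + b - a) * ((a + b).choose a : ℝ) ≤
      (z * Real.exp l + (1 - z)) ^ (a + b) := by
    rw [h]
    refine Finset.single_le_sum
      (f := fun m => (z * Real.exp l) ^ m * (1 - z) ^ (a + b - m) * ((a + b).choose m : ℝ))
      (fun m _ => ?_) (Finset.mem_range.2 (by omega))
    have := sub_nonneg.2 hz1
    positivity
  rw [Nat.add_sub_cancel_left, mul_pow, ← Real.exp_nat_mul] at h1
  have h2 : Real.exp (-(l * a)) * Real.exp (a * l) = 1 := by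
    rw [← Real.exp_add]; ring_nf; simp
  calc ((a + b).choose a : ℝ) * z ^ a * (1 - z) ^ b
      = Real.exp (-(l * a)) * Real.exp (a * l) *
        (((a + b).choose a : ℝ) * z ^ a * (1 - z) ^ b) := by rw [h2, one_mul]
    _ = Real.exp (-(l * a)) * (z ^ a * Real.exp (a * l) * (1 - z) ^ b *
        ((a + b).choose a : ℝ)) := by ring
    _ ≤ _ := by
      rw [add_comm (1 - z)]
      gcongr

lemma one_div_beta_natCast (a b : ℕ) :
    1 / beta (a + 1) (b + 1) = (a + b + 1) * ((a + b).choose a : ℝ) := by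
  have h : (a + 1 + (b + 1) : ℝ) = ((a + b + 1 : ℕ) : ℝ) + 1 := by push_cast; ring
  rw [beta, h, Real.Gamma_nat_eq_factorial, Real.Gamma_nat_eq_factorial,
    Real.Gamma_nat_eq_factorial, one_div_div, Nat.factorial_succ, div_eq_iff (by positivity)]
  have h2 : ((a + b).choose a * a.factorial * b.factorial : ℝ) = (a + b).factorial := by
    have := Nat.choose_mul_factorial_mul_factorial (Nat.le_add_right a b)
    rw [Nat.add_sub_cancel_left] at this
    exact_mod_cast this
  push_cast
  rw [← h2]
  ring

/-- An exponential bound for both tails of a Beta distribution with integer parameters: `l` is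
negative for the upper tail and positive for the lower tail. The density is
`(a + b + 1) * choose (a + b) a * z ^ a * (1 - z) ^ b`, where all but the first factor make up a
binomial probability. -/
lemma betaMeasure_tail_le (a b : ℕ) {l : ℝ} (hl : |l| ≤ 1) (x : ℝ) :
    betaMeasure (a + 1) (b + 1) {z | l * z ≤ l * x} ≤
      ENNReal.ofReal ((a + b + 1) *
        (Real.exp (-(l * a)) * Real.exp (l * x + l ^ 2) ^ (a + b))) := by
  have hS : MeasurableSet {z : ℝ | l * z ≤ l * x} := measurableSet_le (by fun_prop) (by fun_prop)
  rw [betaMeasure, withDensity_apply _ hS]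
  set c := (a + b + 1 : ℝ) * (Real.exp (-(l * a)) * Real.exp (l * x + l ^ 2) ^ (a + b))
  calc ∫⁻ z in {z | l * z ≤ l * x}, betaPDF (a + 1) (b + 1) z
      ≤ ∫⁻ z in {z | l * z ≤ l * x}, (Ioo 0 1).indicator (fun _ => ENNReal.ofReal c) z := by
        refine setLIntegral_mono ((measurable_const).indicator measurableSet_Ioo) fun z hz => ?_
        rw [betaPDF_eq]
        by_cases h : 0 < z ∧ z < 1
        · rw [if_pos h, indicator_of_mem (by exact h), one_div_beta_natCast]
          refine ENNReal.ofReal_le_ofReal ?_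
          have e1 : ((a : ℝ) + 1 - 1) = a := by ring
          have e2 : ((b : ℝ) + 1 - 1) = b := by ring
          rw [e1, e2, Real.rpow_natCast, Real.rpow_natCast, mul_assoc, mul_assoc,
            ← mul_assoc ((a + b).choose a : ℝ)]
          refine mul_le_mul_of_nonneg_left ?_ (by positivity)
          refine (choose_mul_pow_le a b h.1.le h.2.le l).trans ?_
          have h3 : 0 ≤ 1 - z + z * Real.exp l := by
            have := sub_pos.2 h.2
            have := h.1
            positivity
          gcongr
          refine (one_add_mul_exp_le h.1.le h.2.le hl).trans (Real.exp_le_exp.2 ?_)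
          have : l * z ≤ l * x := hz
          linarith
        · rw [if_neg h]; simp
    _ ≤ ∫⁻ z, (Ioo 0 1).indicator (fun _ => ENNReal.ofReal c) z := setLIntegral_le_lintegral _ _
    _ = ENNReal.ofReal c := by
        rw [lintegral_indicator measurableSet_Ioo]; simp

end Beta

/-! ### Learning the service rates -/

section Learning

variable {U K : ℕ} [NeZero K] {I : Instance U K} {𝓔 : Finset (Matching U K)}
  {proj : History U K → (Fin U → Fin K) → Matching U K} {ν : Measure (Fin U → ℕ × ℕ)}
  {Ω : Type*} {X : (i : Source U K) → Ω → i.Val}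

lemma count_history_succ (t : ℕ) (ω : Ω) (u : Fin U) (k : Fin K) (b : Bool) :
    (history proj X (t + 1) ω).count u k b = (history proj X t ω).count u k b +
      if kappa proj X (t + 1) ω u = k ∧ serviceVar X (t + 1) u k ω = b then 1 else 0 := by
  have h : history proj X (t + 1) ω = ((kappa proj X (t + 1) ω,
    fun u => serviceVar X (t + 1) u (kappa proj X (t + 1) ω u) ω) :: history proj X t ω :
      History U K) := rfl
  rw [h, History.count, List.countP_cons]
  congr 1
  by_cases hk : kappa proj X (t + 1) ω u = k
  · subst hk; simp
  · simp [hk]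

lemma pow_count_history_succ (t : ℕ) (ω : Ω) (u : Fin U) (k : Fin K) (x y : ℝ) :
    x ^ (history proj X (t + 1) ω).count u k true *
        y ^ (history proj X (t + 1) ω).count u k false =
      x ^ (history proj X t ω).count u k true * y ^ (history proj X t ω).count u k false *
        if kappa proj X (t + 1) ω u = k then
          (if serviceVar X (t + 1) u k ω then x else y) else 1 := by
  rw [count_history_succ, count_history_succ]
  by_cases hk : kappa proj X (t + 1) ω u = k
  · cases hb : serviceVar X (t + 1) u k ω
    · simp [hk, pow_succ, mul_assoc]
    · simp only [hk, pow_succ, true_and, if_true, Bool.true_eq_false, if_false]; ring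
  · simp [hk]

lemma measurable_indicator_add_indicator_compl {Ω : Type*} [MeasurableSpace Ω] {E : Set Ω}
    {c : ℝ≥0∞} (hE : MeasurableSet E) :
    Measurable fun ω => E.indicator (fun _ => c) ω + Eᶜ.indicator 1 ω :=
  (measurable_const.indicator hE).add (measurable_one.indicator hE.compl)

variable [MeasurableSpace Ω] {P : Measure Ω}

lemma measure_explore_ge (hM : IsModel I 𝓔 ν P X)
    (h𝓔 : IsExploreSet 𝓔) (t : ℕ) (u : Fin U) (k : Fin K) :
    ENNReal.ofReal ((exploreProb K t : ℝ) / K) ≤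
      P {ω | exploreVar X t ω = true ∧ exploreMatchingVar X t ω u = k} := by
  classical
  have hind : IndepFun (exploreVar X t) (exploreMatchingVar X t) P := hM.indep.indepFun (by simp)
  have h2 : MeasurableSet {m : Matching U K | m u = k} := trivial
  have h := hind.measure_inter_preimage_eq_mul {b | b = true} {m : Matching U K | m u = k}
    .of_discrete h2
  have l2 : ENNReal.ofReal (1 / K) ≤ P {ω | exploreMatchingVar X t ω u = k} := by
    rw [(hM.hasLaw_exploreMatching t).measure_eq (p := fun m : Matching U K => m u = k) h2]
    have e2 : {m : Matching U K | m u = k} =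
        ((Finset.univ.filter fun m : Matching U K => m u = k : Finset _) : Set (Matching U K)) := by
      ext; simp
    rw [e2, uniformOn_apply_finset, h𝓔.1, ENNReal.ofReal_div_of_pos
      (by exact_mod_cast Nat.pos_of_ne_zero (NeZero.ne K)), ENNReal.ofReal_one,
      ENNReal.ofReal_natCast]
    gcongr
    obtain ⟨m, hm, hk⟩ := h𝓔.2 u k
    exact_mod_cast Finset.card_pos.2 ⟨m, by simp [hm, hk]⟩
  rw [div_eq_mul_one_div, ENNReal.ofReal_mul (exploreProb K t).2.1]
  refine le_of_le_of_eq ?_ h.symm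
  exact mul_le_mul' (hM.measure_explore_eq_true t).ge l2

/-- In every slot exploration selects the link `(u, k)` with probability at least
`exploreProb K t / K`, independently of the past, and then, as the observed service is independent of
the past and of the schedule, `x ^ successes * y ^ failures` shrinks by the factor `r` in the mean. -/
lemma lintegral_pow_count_le [IsProbabilityMeasure P] (hX : ∀ i, Measurable (X i)) (hM : IsModel I 𝓔 ν P X)
    (h𝓔 : IsExploreSet 𝓔) (u : Fin U) (k : Fin K) {x y r : ℝ} (hx : 0 ≤ x) (hy : 0 ≤ y)
    (hr0 : 0 ≤ r) (hr1 : r ≤ 1) (hxy : I.mu u k * x + (1 - I.mu u k) * y ≤ r) (t : ℕ) :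
    ∫⁻ ω, ENNReal.ofReal (x ^ (history proj X t ω).count u k true *
        y ^ (history proj X t ω).count u k false) ∂P ≤
      ENNReal.ofReal (Real.exp (-((1 - r) * ∑ j ∈ Finset.range t, (exploreProb K (j + 1) : ℝ) / K))) := by
  induction t with
  | zero => simp [history, History.count]
  | succ t ih =>
    let G : Ω → ℝ≥0∞ := fun ω => ENNReal.ofReal (x ^ (history proj X t ω).count u k true *
        y ^ (history proj X t ω).count u k false)
    let Z : Ω → ℝ≥0∞ := fun ω =>
      ENNReal.ofReal (if serviceVar X (t + 1) u k ω then x else y)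
    let A : Ω → ℝ≥0∞ := fun ω => if kappa proj X (t + 1) ω u = k then 0 else G ω
    let B : Ω → ℝ≥0∞ := fun ω => if kappa proj X (t + 1) ω u = k then G ω else 0
    let E : Set Ω := {ω | exploreVar X (t + 1) ω = true ∧
      exploreMatchingVar X (t + 1) ω u = k}
    let W : Ω → ℝ≥0∞ := fun ω => E.indicator (fun _ => ENNReal.ofReal r) ω + Eᶜ.indicator 1 ω
    let S1 : Set (Source U K) := {i | i.time ≤ t + 1 ∧ ∀ u k, i ≠ .service (t + 1) u k}
    let S2 : Set (Source U K) := {i | i.time ≤ t}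
    let T2 : Set (Source U K) := {.explore (t + 1), .exploreMatching (t + 1)}
    have hGm : ∀ m : MeasurableSpace Ω, Measurable[m] (history proj X t) → Measurable[m] G :=
      fun m hm => (measurable_of_countable fun h : History U K =>
        ENNReal.ofReal (x ^ h.count u k true * y ^ h.count u k false)).comp hm
    have hh2 : Measurable[sourceSigma X S2] (history proj X t) :=
      @measurable_history U K _ Ω proj X (sourceSigma X S2) t
        fun i hi => measurable_sourceSigma hi
    have hh1 : Measurable[sourceSigma X S1] (history proj X t) :=
      @measurable_history U K _ Ω proj X (sourceSigma X S1) t fun i hi =>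
        measurable_sourceSigma ⟨by omega, fun u k h => by subst h; simp [Source.time] at hi⟩
    have hk1 : Measurable[sourceSigma X S1] (kappa proj X (t + 1)) :=
      @measurable_kappa U K _ Ω proj X (sourceSigma X S1) t
        fun i hi h => measurable_sourceSigma ⟨hi, h⟩
    have hks : MeasurableSet[sourceSigma X S1] {ω | kappa proj X (t + 1) ω u = k} :=
      hk1 (show MeasurableSet {m : Matching U K | m u = k} from trivial)
    have hA1 : Measurable[sourceSigma X S1] A :=
      @Measurable.ite _ _ _ _ (_) _ _ _ hks (@measurable_const _ _ _ (_) _) (hGm _ hh1)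
    have hB1 : Measurable[sourceSigma X S1] B :=
      @Measurable.ite _ _ _ _ (_) _ _ _ hks (hGm _ hh1) (@measurable_const _ _ _ (_) _)
    have hZ : Measurable[sourceSigma X {.service (t + 1) u k}] Z :=
      (measurable_of_countable fun b : Bool => ENNReal.ofReal (if b then x else y)).comp
        (measurable_sourceSigma (X := X) (mem_singleton (Source.service (t + 1) u k)))
    have hEm : MeasurableSet[sourceSigma X T2] E := by
      refine @MeasurableSet.inter _ (sourceSigma X T2) _ _ ?_ ?_
      · exact measurable_sourceSigma (X := X) (S := T2) (i := .explore (t + 1)) (by simp [T2])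
          (show MeasurableSet {b : Bool | b = true} from .of_discrete)
      · exact measurable_sourceSigma (X := X) (S := T2) (i := .exploreMatching (t + 1))
          (by simp [T2]) (show MeasurableSet {m : Matching U K | m u = k} from trivial)
    have hW : Measurable[sourceSigma X T2] W :=
      @measurable_indicator_add_indicator_compl _ (sourceSigma X T2) _ _ hEm
    have hE : MeasurableSet E := sourceSigma_le hX T2 _ hEm
    have hAB : ∀ ω, A ω + B ω * ENNReal.ofReal r ≤ G ω * W ω := by
      intro ω
      by_cases hω : ω ∈ E
      · have : kappa proj X (t + 1) ω u = k := by
          rw [kappa, schedule_of_explore _ hω.1]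
          exact hω.2
        simp [A, B, W, this, hω]
      · simp only [A, B, W, hω, mem_compl_iff, not_false_eq_true, indicator_of_mem,
          indicator_of_notMem, Pi.one_apply, zero_add, mul_one]
        split_ifs
        · simpa using mul_le_of_le_one_right (a := G ω) zero_le (by simpa using hr1)
        · simp
    have hZint : ∫⁻ ω, Z ω ∂P ≤ ENNReal.ofReal r := by
      have := (hM.hasLaw_service (t + 1) u k).lintegral_comp
        (f := fun b : Bool => ENNReal.ofReal (if b then x else y))
        (measurable_of_countable _).aemeasurable
      refine (this.trans (lintegral_bernoulliLaw _ _)).trans_le ?_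
      have h0 := (I.mu u k).2.1
      have h1 := sub_nonneg.2 (I.mu u k).2.2
      simp only [if_true, Bool.false_eq_true, if_false]
      rw [← ENNReal.ofReal_mul h0, ← ENNReal.ofReal_mul h1,
        ← ENNReal.ofReal_add (by positivity) (by positivity)]
      exact ENNReal.ofReal_le_ofReal hxy
    have hWint : ∫⁻ ω, W ω ∂P ≤
        ENNReal.ofReal (Real.exp (-((1 - r) * ((exploreProb K (t + 1) : ℝ) / K)))) := by
      have h1 : ∫⁻ ω, W ω ∂P = ENNReal.ofReal r * P E + P Eᶜ := by
        rw [lintegral_add_left (measurable_const.indicator hE), lintegral_indicator hE,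
          lintegral_indicator_one hE.compl]
        simp
      have h2 := measure_explore_ge hM h𝓔 (t + 1) u k
      change _ ≤ P E at h2
      rw [ENNReal.ofReal_le_iff_le_toReal (measure_ne_top _ _)] at h2
      change _ ≤ P.real E at h2
      rw [h1, ← ofReal_measureReal, ← ofReal_measureReal, ← ENNReal.ofReal_mul hr0,
        ← ENNReal.ofReal_add (by positivity) (by positivity), probReal_compl_eq_one_sub hE]
      refine ENNReal.ofReal_le_ofReal ?_
      have h3 := Real.add_one_le_exp (-((1 - r) * (exploreProb K (t + 1) / K : ℝ)))
      nlinarith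
    have hd1 : Disjoint S1 {Source.service (t + 1) u k} := by
      rw [Set.disjoint_singleton_right]
      exact fun h => h.2 u k rfl
    have hd2 : Disjoint S2 T2 := by
      rw [Set.disjoint_left]
      rintro i hi (rfl | rfl) <;> simp [S2, Source.time] at hi
    have hle := sourceSigma_le hX S1
    calc ∫⁻ ω, ENNReal.ofReal (x ^ (history proj X (t + 1) ω).count u k true *
          y ^ (history proj X (t + 1) ω).count u k false) ∂P
        = ∫⁻ ω, A ω + B ω * Z ω ∂P := by
          refine lintegral_congr fun ω => ?_
          rw [pow_count_history_succ, ENNReal.ofReal_mul (by positivity)]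
          simp only [A, B, Z, G]
          split_ifs <;> simp
      _ = ∫⁻ ω, A ω ∂P + (∫⁻ ω, B ω ∂P) * ∫⁻ ω, Z ω ∂P := by
          rw [lintegral_add_left (hA1.mono hle le_rfl),
            lintegral_mul_of_sourceSigma hX hM.indep hd1 hB1 hZ]
      _ ≤ ∫⁻ ω, A ω ∂P + (∫⁻ ω, B ω ∂P) * ENNReal.ofReal r := by gcongr
      _ = ∫⁻ ω, A ω + B ω * ENNReal.ofReal r ∂P := by
          rw [lintegral_add_left (hA1.mono hle le_rfl), lintegral_mul_const _ (hB1.mono hle le_rfl)]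
      _ ≤ ∫⁻ ω, G ω * W ω ∂P := lintegral_mono hAB
      _ = (∫⁻ ω, G ω ∂P) * ∫⁻ ω, W ω ∂P :=
          lintegral_mul_of_sourceSigma hX hM.indep hd2 (hGm _ hh2) hW
      _ ≤ _ := by
          refine (mul_le_mul' ih hWint).trans_eq ?_
          rw [← ENNReal.ofReal_mul (Real.exp_pos _).le, ← Real.exp_add, Finset.sum_range_succ, mul_add,
            neg_add]

end Learning

/-! ### Errors of exploitation -/

section Exploitation

lemma gap_le {U K : ℕ} (I : Instance U K) (u : Fin U) {k : Fin K} (hk : k ≠ I.best u) :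
    I.gap ≤ (I.mu u (I.best u) : ℝ) - I.mu u k :=
  ciInf_le (f := fun p : {p : Fin U × Fin K // p.2 ≠ I.best p.1} =>
    ((I.muStar p.1.1 : ℝ) - I.mu p.1.1 p.1.2)) (Set.finite_range _).bddBelow ⟨(u, k), hk⟩

variable {U K : ℕ} [NeZero K] {I : Instance U K} {𝓔 : Finset (Matching U K)}
  {proj : History U K → (Fin U → Fin K) → Matching U K} {ν : Measure (Fin U → ℕ × ℕ)}
  {Ω : Type*} {X : (i : Source U K) → Ω → i.Val}

/-- If the maximizers of the posterior samples are the best servers, then they form a matching, so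
that the projection leaves them unchanged. -/
lemma kappa_eq_best (hproj : IsProjection proj) {t : ℕ} {ω : Ω}
    (hE : exploreVar X (t + 1) ω = false)
    (hθ : ∀ u k, k ≠ I.best u → thetaHat X (t + 1) (history proj X t ω) ω u k <
      thetaHat X (t + 1) (history proj X t ω) ω u (I.best u)) :
    kappa proj X (t + 1) ω = I.best := by
  rw [kappa, schedule_of_not_explore _ hE]
  have h : (fun u => argmax (thetaHat X (t + 1) (history proj X t ω) ω u)) = I.best :=
    funext fun u => argmax_eq_of_forall_lt (hθ u)
  have h2 := hproj (history proj X t ω) I.best I.best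
  rw [hammingDist_self, Nat.le_zero, hammingDist_eq_zero] at h2
  exact (congrArg _ h).trans (DFunLike.coe_injective h2)

variable [MeasurableSpace Ω] {P : Measure Ω}

/-- The posterior sample is drawn independently of the past, so that its tail is the mean of the
Beta tails over the random numbers of successes and failures. -/
lemma measure_thetaHat_le_lintegral (hX : ∀ i, Measurable (X i)) (hM : IsModel I 𝓔 ν P X) (t : ℕ)
    (u : Fin U) (k : Fin K) {l : ℝ} (hl : |l| ≤ 1) (x : ℝ) :
    P {ω | l * thetaHat X (t + 1) (history proj X t ω) ω u k ≤ l * x} ≤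
      ∫⁻ ω, ENNReal.ofReal (((history proj X t ω).count u k true +
        (history proj X t ω).count u k false + 1) *
          (Real.exp (-(l * (history proj X t ω).count u k true)) * Real.exp (l * x + l ^ 2) ^
          ((history proj X t ω).count u k true + (history proj X t ω).count u k false))) ∂P := by
  let N : Ω → ℕ × ℕ := fun ω =>
    ((history proj X t ω).count u k true, (history proj X t ω).count u k false)
  let φ : ℕ × ℕ → ℝ≥0∞ := fun n => ENNReal.ofReal ((n.1 + n.2 + 1) *
    (Real.exp (-(l * n.1)) * Real.exp (l * x + l ^ 2) ^ (n.1 + n.2)))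
  let S : Set (Source U K) := {i | i.time ≤ t}
  have hNS : Measurable[sourceSigma X S] N :=
    (measurable_of_countable fun h : History U K => (h.count u k true, h.count u k false)).comp
      (@measurable_history U K _ Ω proj X (sourceSigma X S) t fun i hi => measurable_sourceSigma hi)
  have hN : Measurable N := hNS.mono (sourceSigma_le hX S) le_rfl
  have hmeas : MeasurableSet {z : ℝ | l * z ≤ l * x} :=
    measurableSet_le (by fun_prop) (by fun_prop)
  let B : ℕ × ℕ → Set Ω := fun n => X (.sample (t + 1) u k n.1 n.2) ⁻¹' {z : ℝ | l * z ≤ l * x}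
  have hsub : {ω | l * thetaHat X (t + 1) (history proj X t ω) ω u k ≤ l * x} ⊆
      ⋃ n, N ⁻¹' {n} ∩ B n := by
    intro ω hω
    exact mem_iUnion.2 ⟨N ω, rfl, hω⟩
  have hterm : ∀ n, P (N ⁻¹' {n} ∩ B n) ≤ φ n * P.map N {n} := by
    intro n
    have hd : Disjoint S {Source.sample (t + 1) u k n.1 n.2} := by
      rw [Set.disjoint_singleton_right]
      intro h
      simp [S, Source.time] at h
    have h1 := (Indep_iff _ _ P).1 (indep_sourceSigma hX hM.indep hd) (N ⁻¹' {n}) (B n)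
      (hNS (measurableSet_singleton n))
      (measurable_sourceSigma (X := X) (mem_singleton (Source.sample (t + 1) u k n.1 n.2)) hmeas)
    rw [h1, Measure.map_apply hN (measurableSet_singleton n), mul_comm]
    refine mul_le_mul' ?_ le_rfl
    refine ((hM.law (.sample (t + 1) u k n.1 n.2)).measure_eq
      (p := fun z : ℝ => l * z ≤ l * x) hmeas).trans_le ?_
    exact betaMeasure_tail_le n.1 n.2 hl x
  calc P {ω | l * thetaHat X (t + 1) (history proj X t ω) ω u k ≤ l * x}
      ≤ ∑' n, P (N ⁻¹' {n} ∩ B n) := (measure_mono hsub).trans (measure_iUnion_le _)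
    _ ≤ ∑' n, φ n * P.map N {n} := ENNReal.tsum_le_tsum hterm
    _ = ∫⁻ ω, φ (N ω) ∂P := by
        rw [← lintegral_countable', lintegral_map (measurable_of_countable _) hN]

/-- Concentration of the posterior samples, with an exponent proportional to the expected number of
explorations of the link. `l` is negative for the upper tail and positive for the lower tail; the
hypothesis `hlx` asks that `x` is so far from the true rate on the side in question that the drift
`l * (x - mu)` outweighs the variances of the observations and of the posterior, with a margin of
`2 * c`. Half of the margin absorbs the linear prefactor of `betaMeasure_tail_le`, the other half is
the decay per observation. -/
lemma measure_thetaHat_le [IsProbabilityMeasure P] (hX : ∀ i, Measurable (X i))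
    (hM : IsModel I 𝓔 ν P X) (h𝓔 : IsExploreSet 𝓔) (t : ℕ) (u : Fin U) (k : Fin K) {l x c : ℝ}
    (hl : |l| ≤ 1) (hc0 : 0 < c) (hc1 : c ≤ 1)
    (hlx : l * (x - I.mu u k) + 2 * l ^ 2 ≤ -(2 * c)) :
    P {ω | l * thetaHat X (t + 1) (history proj X t ω) ω u k ≤ l * x} ≤
      ENNReal.ofReal (1 / c * Real.exp (-((1 - Real.exp (-c)) *
        ∑ j ∈ Finset.range t, (exploreProb K (j + 1) : ℝ) / K))) := by
  refine (measure_thetaHat_le_lintegral hX hM t u k hl x).trans ?_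
  have hp0 := (I.mu u k).2.1
  have hp1 := (I.mu u k).2.2
  set g := Real.exp (l * x + l ^ 2 + c)
  have key := lintegral_pow_count_le (proj := proj) hX hM h𝓔 u k (x := Real.exp (-l) * g) (y := g)
    (r := Real.exp (-c)) (by positivity) (by positivity) (by positivity)
    (Real.exp_le_one_iff.2 (by linarith)) (by
      have h := one_add_mul_exp_le (l := -l) hp0 hp1 (by rwa [abs_neg])
      have h2 : (I.mu u k : ℝ) * (Real.exp (-l) * g) + (1 - I.mu u k) * g =
          (1 - I.mu u k + I.mu u k * Real.exp (-l)) * g := by ring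
      rw [h2]
      refine (mul_le_mul_of_nonneg_right h (Real.exp_pos _).le).trans ?_
      rw [← Real.exp_add]
      exact Real.exp_le_exp.2 (by linarith)) t
  rw [ENNReal.ofReal_mul (by positivity)]
  refine le_trans ?_ (mul_le_mul' le_rfl key)
  rw [← lintegral_const_mul' _ _ ENNReal.ofReal_ne_top]
  refine lintegral_mono fun ω => ?_
  rw [← ENNReal.ofReal_mul (by positivity)]
  refine ENNReal.ofReal_le_ofReal ?_
  generalize (history proj X t ω).count u k true = a
  generalize (history proj X t ω).count u k false = b
  have e1 : Real.exp (-(l * a)) = Real.exp (-l) ^ a := by rw [← Real.exp_nat_mul]; ring_nf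
  have e2 : g = Real.exp (l * x + l ^ 2) * Real.exp c := Real.exp_add _ _
  have e3 : (a + b + 1 : ℝ) ≤ 1 / c * Real.exp c ^ (a + b) := by
    rw [← Real.exp_nat_mul, div_mul_eq_mul_div, one_mul, le_div_iff₀ hc0]
    have := Real.add_one_le_exp (((a + b : ℕ) : ℝ) * c)
    push_cast at this ⊢
    nlinarith
  rw [e1, e2]
  calc (a + b + 1 : ℝ) * (Real.exp (-l) ^ a * Real.exp (l * x + l ^ 2) ^ (a + b))
      ≤ 1 / c * Real.exp c ^ (a + b) *
        (Real.exp (-l) ^ a * Real.exp (l * x + l ^ 2) ^ (a + b)) := by gcongr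
    _ = _ := by ring

/-- If the posterior samples of the best servers are above `mu - Δ / 2` and those of all others below
`mu + Δ / 2`, then exploitation schedules the best matching. -/
lemma measure_exploit_ne_best_le [IsProbabilityMeasure P] (hX : ∀ i, Measurable (X i))
    (hM : IsModel I 𝓔 ν P X) (h𝓔 : IsExploreSet 𝓔) (hproj : IsProjection proj) {Δ : ℝ}
    (hΔ0 : 0 < Δ) (hΔ1 : Δ ≤ 1) (hΔ : ∀ u k, k ≠ I.best u → Δ ≤ (I.mu u (I.best u) : ℝ) - I.mu u k)
    (t : ℕ) :
    P {ω | exploreVar X (t + 1) ω = false ∧ kappa proj X (t + 1) ω ≠ I.best} ≤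
      ENNReal.ofReal (U * K * (64 / Δ ^ 2 * Real.exp (-((1 - Real.exp (-(Δ ^ 2 / 64))) *
        ∑ j ∈ Finset.range t, (exploreProb K (j + 1) : ℝ) / K)))) := by
  classical
  -- `l = ± Δ / 8` minimizes `l * (x - mu) + 2 * l ^ 2` when `x - mu = ∓ Δ / 2`; the minimum is
  -- `-Δ ^ 2 / 32`, whence the constant `c = Δ ^ 2 / 64`
  let l : Fin U → Fin K → ℝ := fun u k => if k = I.best u then Δ / 8 else -(Δ / 8)
  let x : Fin U → Fin K → ℝ := fun u k =>
    if k = I.best u then I.mu u k - Δ / 2 else I.mu u k + Δ / 2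
  let B : Fin U × Fin K → Set Ω := fun p =>
    {ω | l p.1 p.2 * thetaHat X (t + 1) (history proj X t ω) ω p.1 p.2 ≤ l p.1 p.2 * x p.1 p.2}
  have hsub : {ω | exploreVar X (t + 1) ω = false ∧ kappa proj X (t + 1) ω ≠ I.best} ⊆
      ⋃ p ∈ (Finset.univ : Finset (Fin U × Fin K)), B p := by
    rintro ω ⟨hE, hκ⟩
    by_contra hcon
    simp only [Finset.mem_univ, iUnion_true, mem_iUnion, not_exists] at hcon
    refine hκ (kappa_eq_best hproj hE fun u k hk => ?_)
    have h1 := hcon (u, k)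
    have h2 := hcon (u, I.best u)
    simp only [B, l, x, mem_ofPred_eq, hk, if_true, if_false, not_le] at h1 h2
    have h3 := hΔ u k hk
    rw [neg_mul, neg_mul, neg_lt_neg_iff] at h1
    have h1' := lt_of_mul_lt_mul_left h1 (by positivity)
    have h2' := lt_of_mul_lt_mul_left h2 (by positivity)
    linarith
  refine (measure_mono hsub).trans ((measure_biUnion_finset_le _ _).trans ?_)
  refine (Finset.sum_le_sum fun p _ => measure_thetaHat_le hX hM h𝓔 t p.1 p.2
    (c := Δ ^ 2 / 64) (x := x p.1 p.2) (l := l p.1 p.2) ?_ (by positivity) ?_ ?_).trans_eq ?_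
  · simp only [l]
    split_ifs
    · rw [abs_of_nonneg (by positivity)]; linarith
    · rw [abs_neg, abs_of_nonneg (by positivity)]; linarith
  · nlinarith
  · simp only [l, x]
    split_ifs <;> ring_nf <;> rfl
  · rw [Finset.sum_const, ENNReal.ofReal_mul (p := (U * K : ℝ)) (by positivity), one_div_div]
    simp only [Finset.card_univ, Fintype.card_prod, Fintype.card_fin, nsmul_eq_mul]
    congr 1
    rw [← Nat.cast_mul, ENNReal.ofReal_natCast]

end Exploitation

/-! ### The stationary distribution -/

section Stationary

variable {p r : unitInterval} {π : Measure ℕ}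

lemma ofReal_add_ofReal_one_sub (p : unitInterval) :
    ENNReal.ofReal p + ENNReal.ofReal (1 - p) = 1 := by
  rw [← ENNReal.ofReal_add p.2.1 (sub_nonneg.2 p.2.2)]
  simp

/-- In the stationary state the flows across the cut between `n` and `n + 1` balance. -/
lemma IsStationary.cut (h : IsStationary p r π) (n : ℕ) :
    π {n + 1} * ENNReal.ofReal ((1 - p) * r) = π {n} * ENNReal.ofReal (p * (1 - r)) := by
  have := h.1
  let f : ℕ → ℝ≥0∞ := (Ici (n + 1)).indicator 1
  have hf2 : ∫⁻ q, f q ∂π =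
      ∫⁻ q, (∫⁻ a, ∫⁻ s, f (step q a s) ∂bernoulliLaw r ∂bernoulliLaw p) ∂π := by
    conv_lhs => rw [← h.2]
    rw [lintegral_map (measurable_of_countable _) (measurable_of_countable _),
      lintegral_prod _ (measurable_of_countable _).aemeasurable]
    refine lintegral_congr fun q => ?_
    rw [lintegral_prod _ (measurable_of_countable _).aemeasurable]
  have hp := ofReal_add_ofReal_one_sub p
  have hr := ofReal_add_ofReal_one_sub r
  have hpt : ∀ q, (∫⁻ a, ∫⁻ s, f (step q a s) ∂bernoulliLaw r ∂bernoulliLaw p) +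
      ({n + 1} : Set ℕ).indicator 1 q * ENNReal.ofReal ((1 - p) * r) =
      f q + ({n} : Set ℕ).indicator 1 q * ENNReal.ofReal (p * (1 - r)) := by
    intro q
    rw [lintegral_bernoulliLaw, lintegral_bernoulliLaw, lintegral_bernoulliLaw,
      ENNReal.ofReal_mul p.2.1, ENNReal.ofReal_mul (sub_nonneg.2 p.2.2)]
    generalize ENNReal.ofReal p = a at *
    generalize ENNReal.ofReal (1 - p) = a' at *
    generalize ENNReal.ofReal r = b at *
    generalize ENNReal.ofReal (1 - r) = b' at *
    rcases lt_trichotomy q n with hq | rfl | hq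
    · simp [f, step, indicator, show ¬ n + 1 ≤ q by omega, show ¬ n ≤ q by omega,
        show ¬ n + 1 ≤ q - 1 by omega, hq.ne, show q ≠ n + 1 by omega]
    · simp [f, step, indicator, show ¬ q + 1 ≤ q - 1 by omega]
    · rcases (show n + 1 ≤ q from hq).eq_or_lt with rfl | hq'
      · simp only [step, Bool.toNat_true, add_tsub_cancel_right, mem_Ici, le_refl,
          indicator_of_mem, Pi.one_apply, mul_one, Bool.toNat_false, tsub_zero,
          le_add_iff_nonneg_right, zero_le, add_zero, add_le_iff_nonpos_right, nonpos_iff_eq_zero,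
          one_ne_zero, not_false_eq_true, indicator_of_notMem, mul_zero, zero_add,
          mem_singleton_iff, one_mul, zero_mul, f, hr, Nat.add_eq_left]
        rw [add_assoc, ← mul_add, add_comm b', hr, mul_one, hp]
      · simp [f, step, indicator, show n + 1 ≤ q by omega, show n ≤ q by omega, hr, hp,
          show n + 1 ≤ q - 1 by omega, hq.ne', hq'.ne']
  have hint := lintegral_congr (μ := π) hpt
  rw [lintegral_add_left (measurable_of_countable _), lintegral_add_left (measurable_of_countable _),
    ← hf2, lintegral_mul_const _ (measurable_of_countable _),
    lintegral_mul_const _ (measurable_of_countable _), lintegral_indicator_one .of_discrete,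
    lintegral_indicator_one .of_discrete, lintegral_indicator_one .of_discrete] at hint
  exact (ENNReal.add_right_inj (measure_ne_top _ _)).1 hint

lemma IsStationary.real_singleton_le (h : IsStationary p r π) (hpr : p < r) (n : ℕ) :
    π.real {n} ≤ Real.exp (-((r - p : ℝ) * n)) := by
  have := h.1
  have hp0 := p.2.1
  have hr1 := r.2.2
  have hpr' : (p : ℝ) < r := hpr
  induction n with
  | zero => simp
  | succ n ih =>
    have hc := congrArg ENNReal.toReal (h.cut n)
    rw [ENNReal.toReal_mul, ENNReal.toReal_mul, ENNReal.toReal_ofReal (by nlinarith),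
      ENNReal.toReal_ofReal (by nlinarith)] at hc
    change π.real {n + 1} * _ = π.real {n} * _ at hc
    have hD : 0 < (1 - p : ℝ) * r := by nlinarith
    have hD1 : (1 - p : ℝ) * r ≤ 1 := by nlinarith
    have h0 : 0 ≤ π.real {n} := measureReal_nonneg
    have h1 : π.real {n + 1} ≤ (1 - (r - p)) * π.real {n} := by
      refine le_of_mul_le_mul_right ?_ hD
      rw [hc]
      have : (p : ℝ) * (1 - r) ≤ (1 - (r - p)) * ((1 - p) * r) := by nlinarith
      nlinarith
    have h2 : (1 - (r - p) : ℝ) ≤ Real.exp (-(r - p)) := by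
      have := Real.add_one_le_exp (-(r - p : ℝ)); linarith
    calc π.real {n + 1} ≤ (1 - (r - p)) * π.real {n} := h1
      _ ≤ Real.exp (-(r - p)) * Real.exp (-((r - p : ℝ) * n)) := by gcongr
      _ = _ := by rw [← Real.exp_add]; push_cast; ring_nf

/-- The stationary distribution decays like `exp (-(r - p) * n)`, so that it has an exponential moment
of order `(r - p) / 4`, the order at which the net input is shown to have a negative drift. -/
lemma IsStationary.lintegral_exp_le (h : IsStationary p r π) (hpr : p < r) :
    ∫⁻ q, ENNReal.ofReal (Real.exp ((r - p : ℝ) / 4 * q)) ∂π ≤ ENNReal.ofReal (3 / (r - p)) := by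
  have := h.1
  have hε : 0 < (r - p : ℝ) := sub_pos.2 hpr
  have hε1 : (r - p : ℝ) ≤ 1 := by have := p.2.1; have := r.2.2; linarith
  set ε := (r - p : ℝ)
  have hlt : Real.exp (-(3 * ε / 4)) < 1 := by
    rw [Real.exp_lt_one_iff]
    linarith
  rw [lintegral_countable']
  calc ∑' n : ℕ, ENNReal.ofReal (Real.exp (ε / 4 * n)) * π {n}
      ≤ ∑' n : ℕ, ENNReal.ofReal (Real.exp (-(3 * ε / 4)) ^ n) := by
        refine ENNReal.tsum_le_tsum fun n => ?_
        rw [← ofReal_measureReal, ← ENNReal.ofReal_mul (Real.exp_pos _).le]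
        refine ENNReal.ofReal_le_ofReal ?_
        refine (mul_le_mul_of_nonneg_left (h.real_singleton_le hpr n) (Real.exp_pos _).le).trans_eq ?_
        rw [← Real.exp_add, ← Real.exp_nat_mul]
        congr 1
        simp only [ε]
        ring
    _ = ENNReal.ofReal (1 - Real.exp (-(3 * ε / 4)))⁻¹ := by
        rw [← ENNReal.ofReal_tsum_of_nonneg (fun n => by positivity)
          (summable_geometric_of_lt_one (Real.exp_pos _).le hlt),
          tsum_geometric_of_lt_one (Real.exp_pos _).le hlt]
    _ ≤ ENNReal.ofReal (3 / ε) := by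
        refine ENNReal.ofReal_le_ofReal ?_
        rw [inv_le_comm₀ (by linarith) (by positivity), inv_div]
        have h1 : Real.exp (-(3 * ε / 4)) ≤ (1 + 3 * ε / 4)⁻¹ := by
          rw [Real.exp_neg]
          exact inv_anti₀ (by positivity) (by linarith [Real.add_one_le_exp (3 * ε / 4)])
        have h2 : (1 + 3 * ε / 4)⁻¹ ≤ 1 - ε / 3 := by
          rw [inv_le_iff_one_le_mul₀ (by positivity)]
          nlinarith
        linarith

lemma lintegral_stationary_lt_top (hπ : IsStationary p r π)
    (hpr : p < r) : ∫⁻ n : ℕ, (n : ℝ≥0∞) ∂π < ∞ := by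
  have hε : 0 < (r - p : ℝ) := sub_pos.2 hpr
  have h1 : ∀ n : ℕ, (n : ℝ≥0∞) ≤ ENNReal.ofReal (4 / (r - p)) *
      ENNReal.ofReal (Real.exp ((r - p : ℝ) / 4 * n)) := by
    intro n
    rw [← ENNReal.ofReal_mul (by positivity), ← ENNReal.ofReal_natCast]
    refine ENNReal.ofReal_le_ofReal ?_
    have := Real.add_one_le_exp ((r - p : ℝ) / 4 * n)
    calc (n : ℝ) = 4 / (r - p) * ((r - p) / 4 * n) := by field_simp
      _ ≤ _ := by gcongr; linarith
  refine (lintegral_mono h1).trans_lt ?_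
  rw [lintegral_const_mul' _ _ ENNReal.ofReal_ne_top]
  exact (mul_le_mul' le_rfl (hπ.lintegral_exp_le hpr)).trans_lt
    (ENNReal.mul_lt_top ENNReal.ofReal_lt_top ENNReal.ofReal_lt_top)

end Stationary

/-! ### Sample paths of queues -/

section Paths

variable {q q' : ℕ → ℕ} {a s s' : ℕ → Bool} {b : ℕ → ℕ}

/-- Two queues with the same arrivals differ by no more than the number of slots in which their
services differ. -/
lemma path_le_add_sum (hq : ∀ t, q (t + 1) = step (q t) (a (t + 1)) (s (t + 1)))
    (hq' : ∀ t, q' (t + 1) = step (q' t) (a (t + 1)) (s' (t + 1))) {σ t : ℕ}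
    (hb : ∀ l ∈ Finset.Ioc σ t, b l = 0 → s l = s' l)
    (hσt : σ ≤ t) (hσ : q σ ≤ q' σ) : q t ≤ q' t + ∑ l ∈ Finset.Ioc σ t, b l := by
  induction t, hσt using Nat.le_induction with
  | base => simpa using hσ
  | succ t hσt ih =>
    have ih := ih fun l hl => hb l (Finset.Ioc_subset_Ioc_right (Nat.le_succ t) hl)
    have hb := hb (t + 1) (by simp; omega)
    rw [Finset.sum_Ioc_succ_top hσt, hq, hq', step, step]
    have h1 := Bool.toNat_le (s (t + 1))
    have h2 := Bool.toNat_le (s' (t + 1))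
    rcases Nat.eq_zero_or_pos (b (t + 1)) with h0 | h0
    · rw [hb h0]; omega
    · omega

/-- As long as the queue does not empty, no service is lost. -/
lemma path_eq_add_sum (hq : ∀ t, q (t + 1) = step (q t) (a (t + 1)) (s (t + 1))) {σ t : ℕ}
    (hσt : σ ≤ t) (hpos : ∀ l ∈ Finset.Ioc σ t, 0 < q l) :
    (q t : ℤ) = q σ + ∑ l ∈ Finset.Ioc σ t, (((a l).toNat : ℤ) - (s l).toNat) := by
  induction t, hσt using Nat.le_induction with
  | base => simp
  | succ t hσt ih =>
    have ih := ih fun l hl => hpos l (Finset.Ioc_subset_Ioc_right (Nat.le_succ t) hl)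
    have hp := hpos (t + 1) (by simp; omega)
    rw [Finset.sum_Ioc_succ_top hσt]
    rw [hq, step] at hp ⊢
    omega

/-- If the queue does not empty in the last `n` slots, then its current busy period began at some
earlier time `σ`, since when there have been more arrivals than services. -/
lemma exists_empty_or_sum_pos (hq : ∀ t, q (t + 1) = step (q t) (a (t + 1)) (s (t + 1))) {n t : ℕ}
    (hb : ∀ l ∈ Finset.Ioc 0 t, b l = 0 → s l = s' l) :
    (∃ σ, t - n ≤ σ ∧ σ ≤ t ∧ q σ = 0) ∨ ∃ σ ≤ t - n,
      (0 : ℤ) < (if σ = 0 then (q 0 : ℤ) else 0) +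
        ∑ l ∈ Finset.Ioc σ t, (((a l).toNat : ℤ) - (s' l).toNat + b l) := by
  classical
  by_cases h : ∃ σ, t - n ≤ σ ∧ σ ≤ t ∧ q σ = 0
  · exact .inl h
  · refine .inr ?_
    push Not at h
    set σ := Nat.findGreatest (fun j => q j = 0) (t - n) with hσdef
    have hσle : σ ≤ t - n := Nat.findGreatest_le _
    have hpos : ∀ l ∈ Finset.Ioc σ t, 0 < q l := by
      intro l hl
      rw [Finset.mem_Ioc] at hl
      refine Nat.pos_of_ne_zero ?_
      rcases le_total l (t - n) with hl' | hl'
      · exact Nat.findGreatest_is_greatest (P := fun j => q j = 0) hl.1 hl'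
      · exact h l hl' hl.2
    refine ⟨σ, hσle, ?_⟩
    have h1 := path_eq_add_sum hq (hσle.trans (Nat.sub_le _ _)) hpos
    have h2 : 0 < q t := Nat.pos_of_ne_zero (h t (Nat.sub_le _ _) le_rfl)
    have h3 : q σ ≤ if σ = 0 then (q 0) else 0 := by
      split_ifs with h0
      · rw [h0]
      · exact (Nat.findGreatest_of_ne_zero hσdef.symm h0).le
    have h4 : ∑ l ∈ Finset.Ioc σ t, (((a l).toNat : ℤ) - (s l).toNat) ≤
        ∑ l ∈ Finset.Ioc σ t, (((a l).toNat : ℤ) - (s' l).toNat + b l) := by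
      refine Finset.sum_le_sum fun l hl => ?_
      have e2 := Bool.toNat_le (s' l)
      rcases Nat.eq_zero_or_pos (b l) with h0 | h0
      · rw [hb l (Finset.Ioc_subset_Ioc_left (Nat.zero_le _) hl) h0]; omega
      · omega
    have h5 : (q σ : ℤ) ≤ if σ = 0 then (q 0 : ℤ) else 0 := by exact_mod_cast h3
    linarith [show (0 : ℤ) < q t by exact_mod_cast h2]

end Paths

/-! ### The queue under the optimal matching -/

section OptimalQueue

variable {U K : ℕ} {Ω : Type*}

/-- The queue of `u` under the optimal matching, started from the length `q₀`. -/
def optimalQueue (I : Instance U K) (X : (i : Source U K) → Ω → i.Val) (u : Fin U) (q₀ : Ω → ℕ) :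
    ℕ → Ω → ℕ
  | 0, ω => q₀ ω
  | t + 1, ω => step (optimalQueue I X u q₀ t ω) (arrivalVar X (t + 1) u ω)
      (serviceVar X (t + 1) u (I.best u) ω)

variable {I : Instance U K} {X : (i : Source U K) → Ω → i.Val}

lemma queueStar_eq_optimalQueue (u : Fin U) (t : ℕ) :
    queueStar I X u t = optimalQueue I X u (fun ω => (initVar X ω u).2) t := by
  induction t with
  | zero => rfl
  | succ t ih => funext ω; simp only [queueStar, optimalQueue, ih]

lemma measurable_optimalQueue [MeasurableSpace Ω] {t : ℕ} {u : Fin U} {q₀ : Ω → ℕ}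
    (hX : ∀ i : Source U K, i.time ≤ t → Measurable (X i)) (hq : Measurable q₀) :
    Measurable (optimalQueue I X u q₀ t) := by
  induction t with
  | zero => exact hq
  | succ t ih =>
    have h1 : Measurable (arrivalVar X (t + 1) u) := hX (.arrival (t + 1) u) le_rfl
    have h2 : Measurable (serviceVar X (t + 1) u (I.best u)) :=
      hX (.service (t + 1) u (I.best u)) le_rfl
    exact (measurable_of_countable fun x : ℕ × Bool × Bool => step x.1 x.2.1 x.2.2).comp
      ((ih fun i hi => hX i (by omega)).prodMk (h1.prodMk h2))

variable [MeasurableSpace Ω] {P : Measure Ω} {𝓔 : Finset (Matching U K)}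
  {ν : Measure (Fin U → ℕ × ℕ)}

/-- The stationary distribution is preserved. The initial length is a function of the source `init`
alone, hence independent of all arrivals and services. -/
lemma map_optimalQueue [IsProbabilityMeasure P] (hX : ∀ i, Measurable (X i))
    (hM : IsModel I 𝓔 ν P X) {u : Fin U} {q₀ : Ω → ℕ}
    (hq : Measurable[sourceSigma X {.init}] q₀)
    {π : Measure ℕ} (hπ : IsStationary (I.lam u) (I.muStar u) π) (h0 : P.map q₀ = π) (t : ℕ) :
    P.map (optimalQueue I X u q₀ t) = π := by
  induction t with
  | zero => exact h0
  | succ t ih =>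
    let S : Set (Source U K) := {i | i.time ≤ t}
    let T : Set (Source U K) := {.arrival (t + 1) u, .service (t + 1) u (I.best u)}
    let V : Ω → Bool × Bool := fun ω =>
      (arrivalVar X (t + 1) u ω, serviceVar X (t + 1) u (I.best u) ω)
    have hST : Disjoint S T := by
      rw [Set.disjoint_left]
      rintro i hi (rfl | rfl) <;> simp [S, Source.time] at hi
    have hqS : Measurable[sourceSigma X S] q₀ :=
      hq.mono (iSup₂_le fun i hi => le_iSup₂_of_le i (by
        rw [mem_singleton_iff.1 hi]; exact Nat.zero_le t) le_rfl) le_rfl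
    have hc : Measurable[sourceSigma X S] (optimalQueue I X u q₀ t) :=
      @measurable_optimalQueue U K Ω I X (sourceSigma X S) t u q₀
        (fun i hi => measurable_sourceSigma hi) hqS
    have hV1 : Measurable[sourceSigma X T] (arrivalVar X (t + 1) u) :=
      measurable_sourceSigma (i := .arrival (t + 1) u) (by simp [T])
    have hV2 : Measurable[sourceSigma X T] (serviceVar X (t + 1) u (I.best u)) :=
      measurable_sourceSigma (i := .service (t + 1) u (I.best u)) (by simp [T])
    have hV : Measurable[sourceSigma X T] V :=
      hV1.prodMk hV2
    have hind : IndepFun (optimalQueue I X u q₀ t) V P :=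
      indep_of_indep_of_le_left (indep_of_indep_of_le_right
        (indep_sourceSigma hX hM.indep hST) hV.comap_le) hc.comap_le
    have hind2 : IndepFun (arrivalVar X (t + 1) u) (serviceVar X (t + 1) u (I.best u)) P :=
      hM.indep.indepFun (by simp)
    have hcm := hc.mono (sourceSigma_le hX S) le_rfl
    have hVm := hV.mono (sourceSigma_le hX T) le_rfl
    have h1 := (indepFun_iff_map_prod_eq_prod_map_map hcm.aemeasurable hVm.aemeasurable).1 hind
    have h2 := (indepFun_iff_map_prod_eq_prod_map_map
      (hM.hasLaw_arrival (t + 1) u).aemeasurable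
      (hM.hasLaw_service (t + 1) u (I.best u)).aemeasurable).1 hind2
    rw [(hM.hasLaw_arrival (t + 1) u).map_eq,
      (hM.hasLaw_service (t + 1) u (I.best u)).map_eq] at h2
    rw [ih, show P.map V = _ from h2] at h1
    have h3 : optimalQueue I X u q₀ (t + 1) = (fun x : ℕ × Bool × Bool => step x.1 x.2.1 x.2.2) ∘
        fun ω => (optimalQueue I X u q₀ t ω, V ω) := rfl
    rw [h3, ← Measure.map_map (measurable_of_countable _) (hcm.prodMk hVm), h1]
    exact hπ.2

/-- Queues under the optimal matching which start from the stationary distribution have the same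
finite mean at all times. -/
lemma lintegral_optimalQueue [IsProbabilityMeasure P] (hX : ∀ i, Measurable (X i))
    (hM : IsModel I 𝓔 ν P X) {u : Fin U} {π : Measure ℕ}
    (hπ : IsStationary (I.lam u) (I.muStar u) π) {f : (Fin U → ℕ × ℕ) → ℕ}
    (hf : ν.map f = π) (t : ℕ) :
    ∫⁻ ω, (optimalQueue I X u (fun ω => f (initVar X ω)) t ω : ℝ≥0∞) ∂P =
      ∫⁻ n : ℕ, (n : ℝ≥0∞) ∂π := by
  have hfm : Measurable f := measurable_of_countable f
  have hlaw : HasLaw (initVar X) ν P := hM.law .init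
  have hq : Measurable[sourceSigma X {.init}] fun ω => f (initVar X ω) :=
    hfm.comp (measurable_sourceSigma (X := X) (i := .init) rfl)
  have hqm : Measurable fun ω => f (initVar X ω) := hfm.comp (hX .init)
  have h0 : P.map (fun ω => f (initVar X ω)) = π := by
    rw [← hf, ← hlaw.map_eq]
    exact (Measure.map_map hfm (hX .init)).symm
  rw [← map_optimalQueue hX hM hq hπ h0 t, lintegral_map (measurable_of_countable _)
    (measurable_optimalQueue (fun i _ => hX i) hqm)]

end OptimalQueue

/-! ### Exponential moments of the net input -/

section NetInput

variable {U K : ℕ} {Ω : Type*} {I : Instance U K} {X : (i : Source U K) → Ω → i.Val}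

/-- The net input of the queue of `u` in slot `l` under the optimal matching, if moreover every
exploration costs one unit. -/
def netInput (I : Instance U K) (X : (i : Source U K) → Ω → i.Val) (u : Fin U) (l : ℕ) (ω : Ω) :
    ℤ :=
  (arrivalVar X l u ω).toNat - (serviceVar X l u (I.best u) ω).toNat + (exploreVar X l ω).toNat

lemma exp_le_quadratic {x : ℝ} (hx : |x| ≤ 1 / 4) : Real.exp x ≤ 1 + x + 0.6 * x ^ 2 := by
  have h := (abs_le.1 (Real.exp_bound (hx.trans (by norm_num)) (n := 3) (by norm_num))).2
  norm_num [Finset.sum_range_succ, Nat.factorial] at h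
  have h2 : |x| ^ 3 ≤ 1 / 4 * x ^ 2 := by
    rw [pow_succ', sq_abs]
    gcongr
  nlinarith [sq_nonneg x]

lemma measurable_mul_of_measurable {Ω : Type*} {m : MeasurableSpace Ω} {f g : Ω → ℝ≥0∞}
    (hf : Measurable[m] f) (hg : Measurable[m] g) : Measurable[m] fun ω => f ω * g ω :=
  hf.mul hg

lemma lintegral_exp_bernoulliLaw (p : unitInterval) {η : ℝ} (hη : |η| ≤ 1 / 4) :
    ∫⁻ b, ENNReal.ofReal (Real.exp (η * (b.toNat : ℝ))) ∂bernoulliLaw p ≤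
      ENNReal.ofReal (Real.exp (p * (η + 0.6 * η ^ 2))) := by
  have h0 := p.2.1
  have h1 := sub_nonneg.2 p.2.2
  rw [lintegral_bernoulliLaw, ← ENNReal.ofReal_mul h0, ← ENNReal.ofReal_mul h1,
    ← ENNReal.ofReal_add (by positivity) (by positivity)]
  refine ENNReal.ofReal_le_ofReal ?_
  have h2 := exp_le_quadratic hη
  have h3 := Real.add_one_le_exp (p * (η + 0.6 * η ^ 2))
  simp only [Bool.toNat_true, Bool.toNat_false, Nat.cast_one, Nat.cast_zero, mul_one, mul_zero,
    Real.exp_zero]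
  nlinarith

lemma eps_pos (I : Instance U K) (u : Fin U) : 0 < I.eps u := sub_pos.2 (I.stable u)

lemma eps_le_one (I : Instance U K) (u : Fin U) : I.eps u ≤ 1 := by
  have := (I.muStar u).2.2
  have := (I.lam u).2.1
  simp only [Instance.eps]
  linarith

lemma measurable_netInput {m : MeasurableSpace Ω} {u : Fin U} {l : ℕ}
    (hX : ∀ i : Source U K, i ∈ ({.arrival l u, .service l u (I.best u), .explore l} :
      Set (Source U K)) → Measurable[m] (X i)) : Measurable[m] (netInput I X u l) := by
  have h1 : Measurable (arrivalVar X l u) := hX (.arrival l u) (by simp)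
  have h2 : Measurable (serviceVar X l u (I.best u)) := hX (.service l u (I.best u)) (by simp)
  have h3 : Measurable (exploreVar X l) := hX (.explore l) (by simp)
  exact (measurable_of_countable fun x : Bool × Bool × Bool =>
    (x.1.toNat : ℤ) - x.2.1.toNat + x.2.2.toNat).comp (h1.prodMk (h2.prodMk h3))

variable [MeasurableSpace Ω] {P : Measure Ω} {𝓔 : Finset (Matching U K)}
  {ν : Measure (Fin U → ℕ × ℕ)}

/-- The moment of order `ε / 4`: the mean drift `-ε` contributes `-ε ^ 2 / 4` to the exponent, of which
the variances of the arrival and the service leave at least `0.175 * ε ^ 2`. -/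
lemma lintegral_exp_netInput_le (hX : ∀ i, Measurable (X i)) (hM : IsModel I 𝓔 ν P X) (u : Fin U)
    (l : ℕ) :
    ∫⁻ ω, ENNReal.ofReal (Real.exp (I.eps u / 4 * netInput I X u l ω)) ∂P ≤
      ENNReal.ofReal (Real.exp (-(0.175 * I.eps u ^ 2) + 0.3 * I.eps u * exploreProb K l)) := by
  have hε0 := eps_pos I u
  have hε1 := eps_le_one I u
  set η := I.eps u / 4 with hη
  have hη1 : |η| ≤ 1 / 4 := by rw [abs_of_nonneg (by positivity)]; linarith
  have hη2 : |-η| ≤ 1 / 4 := by rwa [abs_neg]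
  let f : ℝ → Bool → ℝ≥0∞ := fun η b => ENNReal.ofReal (Real.exp (η * (b.toNat : ℝ)))
  have hm : ∀ (S : Set (Source U K)) (Y : Ω → Bool) (η : ℝ), Measurable[sourceSigma X S] Y →
      Measurable[sourceSigma X S] fun ω => f η (Y ω) :=
    fun S Y η hY => (measurable_of_countable (f η)).comp hY
  have e : ∀ ω, ENNReal.ofReal (Real.exp (η * netInput I X u l ω)) =
      f η (arrivalVar X l u ω) *
        (f (-η) (serviceVar X l u (I.best u) ω) * f η (exploreVar X l ω)) := by
    intro ω
    simp only [f, netInput]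
    rw [← ENNReal.ofReal_mul (Real.exp_pos _).le, ← ENNReal.ofReal_mul (Real.exp_pos _).le,
      ← Real.exp_add, ← Real.exp_add]
    push_cast
    ring_nf
  have hE : Measurable[sourceSigma X {.explore l}] fun ω => f η (exploreVar X l ω) :=
    hm _ _ _ (measurable_sourceSigma (i := .explore l) rfl)
  have hR : Measurable[sourceSigma X {.service l u (I.best u)}]
      fun ω => f (-η) (serviceVar X l u (I.best u) ω) :=
    hm _ _ _ (measurable_sourceSigma (i := .service l u (I.best u)) rfl)
  have hA : Measurable[sourceSigma X {.arrival l u}] fun ω => f η (arrivalVar X l u ω) :=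
    hm _ _ _ (measurable_sourceSigma (i := .arrival l u) rfl)
  let T : Set (Source U K) := {.service l u (I.best u), .explore l}
  have hRE : Measurable[sourceSigma X T]
      fun ω => f (-η) (serviceVar X l u (I.best u) ω) * f η (exploreVar X l ω) :=
    measurable_mul_of_measurable
      (hm _ _ _ (measurable_sourceSigma (i := .service l u (I.best u)) (by simp [T])))
      (hm _ _ _ (measurable_sourceSigma (i := .explore l) (by simp [T])))
  have hd1 : Disjoint {.arrival l u} T := by
    rw [Set.disjoint_singleton_left]; simp [T]
  have hd2 : Disjoint ({.service l u (I.best u)} : Set (Source U K)) {.explore l} := by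
    rw [Set.disjoint_singleton_left]; simp
  simp_rw [e]
  rw [lintegral_mul_of_sourceSigma hX hM.indep hd1 hA hRE,
    lintegral_mul_of_sourceSigma hX hM.indep hd2 hR hE,
    (hM.hasLaw_arrival l u).lintegral_comp (measurable_of_countable _).aemeasurable,
    (hM.hasLaw_service l u (I.best u)).lintegral_comp (measurable_of_countable _).aemeasurable,
    (hM.hasLaw_explore l).lintegral_comp (measurable_of_countable _).aemeasurable]
  refine (mul_le_mul' (lintegral_exp_bernoulliLaw _ hη1) (mul_le_mul'
    (lintegral_exp_bernoulliLaw _ hη2) (lintegral_exp_bernoulliLaw _ hη1))).trans ?_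
  rw [← ENNReal.ofReal_mul (Real.exp_pos _).le, ← ENNReal.ofReal_mul (Real.exp_pos _).le,
    ← Real.exp_add, ← Real.exp_add]
  refine ENNReal.ofReal_le_ofReal (Real.exp_le_exp.2 ?_)
  have h1 := (I.lam u).2.2
  have h2 := (I.mu u (I.best u)).2.2
  have h3 := (exploreProb K l).2.1
  have h4 : I.eps u = (I.mu u (I.best u) : ℝ) - I.lam u := rfl
  have h5 : (I.lam u : ℝ) * (η + 0.6 * η ^ 2) + I.mu u (I.best u) * (-η + 0.6 * (-η) ^ 2) ≤
      -(0.175 * I.eps u ^ 2) := by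
    have : (I.lam u + I.mu u (I.best u) : ℝ) * (0.6 * η ^ 2) ≤ 2 * (0.6 * η ^ 2) := by
      gcongr; linarith
    have h6 : (I.lam u : ℝ) * η - I.mu u (I.best u) * η = -(I.eps u * η) := by rw [h4]; ring
    rw [hη] at *
    nlinarith
  have h7 : (exploreProb K l : ℝ) * (η + 0.6 * η ^ 2) ≤ 0.3 * I.eps u * exploreProb K l := by
    rw [mul_comm]
    refine mul_le_mul_of_nonneg_right ?_ h3
    rw [hη]
    nlinarith
  linarith

/-- The net inputs of different slots are independent of each other and of the initial lengths. -/
lemma lintegral_exp_sum_netInput_le (hX : ∀ i, Measurable (X i)) (hM : IsModel I 𝓔 ν P X)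
    (u : Fin U) {g : Ω → ℝ≥0∞} (hg : Measurable[sourceSigma X {.init}] g) {σ t : ℕ} (hσt : σ ≤ t) :
    ∫⁻ ω, g ω * ENNReal.ofReal (Real.exp (I.eps u / 4 *
        (∑ l ∈ Finset.Ioc σ t, netInput I X u l ω : ℤ))) ∂P ≤
      (∫⁻ ω, g ω ∂P) * ENNReal.ofReal (Real.exp (-(0.175 * I.eps u ^ 2 * (t - σ)) +
        0.3 * I.eps u * ∑ l ∈ Finset.Ioc σ t, (exploreProb K l : ℝ))) := by
  induction t, hσt using Nat.le_induction with
  | base => simp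
  | succ t hσt ih =>
    let S : Set (Source U K) := {i | i.time ≤ t}
    let T : Set (Source U K) :=
      {.arrival (t + 1) u, .service (t + 1) u (I.best u), .explore (t + 1)}
    have hST : Disjoint S T := by
      rw [Set.disjoint_left]
      rintro i hi (rfl | rfl | rfl) <;> simp [S, Source.time] at hi
    let e : ℤ → ℝ≥0∞ := fun z => ENNReal.ofReal (Real.exp (I.eps u / 4 * z))
    have hgS : Measurable[sourceSigma X S] g :=
      hg.mono (iSup₂_le fun i hi => le_iSup₂_of_le i (by
        rw [mem_singleton_iff.1 hi]; exact Nat.zero_le t) le_rfl) le_rfl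
    have hN : Measurable[sourceSigma X S] fun ω => ∑ l ∈ Finset.Ioc σ t, netInput I X u l ω := by
      refine @Finset.measurable_fun_sum _ _ _ _ _ _ (sourceSigma X S) _ _ fun l hl => ?_
      refine measurable_netInput fun i hi => measurable_sourceSigma ?_
      have := (Finset.mem_Ioc.1 hl).2
      rcases hi with rfl | rfl | rfl <;> exact this
    have hS : Measurable[sourceSigma X S] fun ω =>
        g ω * e (∑ l ∈ Finset.Ioc σ t, netInput I X u l ω) :=
      measurable_mul_of_measurable hgS ((measurable_of_countable e).comp hN)
    have hT : Measurable[sourceSigma X T] fun ω => e (netInput I X u (t + 1) ω) :=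
      (measurable_of_countable e).comp
        (measurable_netInput fun i hi => measurable_sourceSigma hi)
    have h : ∀ ω, g ω * ENNReal.ofReal (Real.exp (I.eps u / 4 *
        (∑ l ∈ Finset.Ioc σ (t + 1), netInput I X u l ω : ℤ))) =
        g ω * e (∑ l ∈ Finset.Ioc σ t, netInput I X u l ω) * e (netInput I X u (t + 1) ω) := by
      intro ω
      rw [Finset.sum_Ioc_succ_top hσt, mul_assoc]
      simp only [e]
      rw [← ENNReal.ofReal_mul (Real.exp_pos _).le, ← Real.exp_add]
      push_cast
      rw [mul_add]
    simp_rw [h]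
    rw [lintegral_mul_of_sourceSigma hX hM.indep hST hS hT]
    refine (mul_le_mul' ih (lintegral_exp_netInput_le hX hM u (t + 1))).trans_eq ?_
    rw [mul_assoc, ← ENNReal.ofReal_mul (Real.exp_pos _).le, ← Real.exp_add,
      Finset.sum_Ioc_succ_top hσt]
    push_cast
    ring_nf

lemma lintegral_exp_init_le (hM : IsModel I 𝓔 ν P X) {u : Fin U} {π : Measure ℕ}
    (hπ : IsStationary (I.lam u) (I.muStar u) π) (h0 : ν.map (fun q => (q u).1) = π) :
    ∫⁻ ω, ENNReal.ofReal (Real.exp (I.eps u / 4 * ((initVar X ω u).1 : ℤ))) ∂P ≤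
      ENNReal.ofReal (3 / I.eps u) := by
  have hlaw : HasLaw (initVar X) ν P := hM.law .init
  rw [hlaw.lintegral_comp
    (f := fun q => ENNReal.ofReal (Real.exp (I.eps u / 4 * ((q u).1 : ℤ))))
    (measurable_of_countable _).aemeasurable,
    ← lintegral_map (f := fun n : ℕ => ENNReal.ofReal (Real.exp (I.eps u / 4 * (n : ℤ))))
    (g := fun q : Fin U → ℕ × ℕ => (q u).1)
    (measurable_of_countable _) (measurable_of_countable _), h0]
  simp only [Int.cast_natCast]
  exact hπ.lintegral_exp_le (I.stable u)

/-- Markov's inequality for an exponential. -/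
lemma measure_pos_le_lintegral_exp {N : Ω → ℤ} (hN : Measurable N) {η : ℝ} (hη : 0 ≤ η) :
    P {ω | 0 < N ω} ≤ ∫⁻ ω, ENNReal.ofReal (Real.exp (η * N ω)) ∂P := by
  have hS : MeasurableSet {ω | 0 < N ω} := measurableSet_lt measurable_const hN
  rw [← lintegral_indicator_one hS]
  refine lintegral_mono fun ω => indicator_apply_le' (fun hω => ?_) fun _ => zero_le
  have hω' : (0 : ℝ) ≤ N ω := by exact_mod_cast (show (0 : ℤ) < N ω from hω).le
  exact ENNReal.one_le_ofReal.2 (Real.one_le_exp (by positivity))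

/-- A bound for the probability that a busy period of the queue of `u` which starts at time `σ`
lasts until time `t`, when in the slots up to `m` every service may be lost. -/
lemma measure_sum_pos_le [IsProbabilityMeasure P] (hX : ∀ i, Measurable (X i))
    (hM : IsModel I 𝓔 ν P X) {u : Fin U} {π : Measure ℕ}
    (hπ : IsStationary (I.lam u) (I.muStar u) π)
    (h0 : ν.map (fun q => (q u).1) = π) {σ t : ℕ} (hσt : σ ≤ t) (m : ℕ) :
    P {ω | 0 < (if σ = 0 then ((initVar X ω u).1 : ℤ) else 0) + (m - σ : ℕ) +
      ∑ l ∈ Finset.Ioc σ t, netInput I X u l ω} ≤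
      ENNReal.ofReal ((if σ = 0 then 3 / I.eps u else 1) *
        Real.exp (I.eps u / 4 * (m - σ : ℕ) - 0.175 * I.eps u ^ 2 * (t - σ) +
          0.3 * I.eps u * ∑ l ∈ Finset.Ioc σ t, (exploreProb K l : ℝ))) := by
  have hε0 := eps_pos I u
  set c : ℝ := if σ = 0 then 3 / I.eps u else 1
  have hc : 0 ≤ c := by simp only [c]; split_ifs <;> positivity
  obtain ⟨Y, hYdef⟩ : ∃ Y : Ω → ℤ, Y = fun ω => if σ = 0 then ((initVar X ω u).1 : ℤ) else 0 :=
    ⟨_, rfl⟩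
  have hY : Measurable[sourceSigma X {.init}] Y := by
    have hinit : Measurable[sourceSigma X {.init}] (initVar X) :=
      measurable_sourceSigma (i := .init) rfl
    rw [hYdef]
    exact (measurable_of_countable fun q : Fin U → ℕ × ℕ =>
      if σ = 0 then ((q u).1 : ℤ) else 0).comp hinit
  have hYint : ∫⁻ ω, ENNReal.ofReal (Real.exp (I.eps u / 4 * Y ω)) ∂P ≤ ENNReal.ofReal c := by
    by_cases h : σ = 0
    · simp only [hYdef, c, h, if_true]
      exact lintegral_exp_init_le hM hπ h0
    · simp [hYdef, c, h]
  have hle := sourceSigma_le hX ({.init} : Set (Source U K))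
  have hYm : Measurable Y := hY.mono hle le_rfl
  have hD : Measurable fun ω => ∑ l ∈ Finset.Ioc σ t, netInput I X u l ω :=
    Finset.measurable_fun_sum _ fun l _ => measurable_netInput fun i _ => hX i
  have hN : Measurable fun ω => Y ω + (m - σ : ℕ) + ∑ l ∈ Finset.Ioc σ t, netInput I X u l ω :=
    (measurable_of_countable fun z : ℤ × ℤ => z.1 + (m - σ : ℕ) + z.2).comp (hYm.prodMk hD)
  have h1 := measure_pos_le_lintegral_exp (P := P) hN (η := I.eps u / 4) (by positivity)
  have hg : Measurable[sourceSigma X {.init}]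
      fun ω => ENNReal.ofReal (Real.exp (I.eps u / 4 * Y ω)) :=
    (measurable_of_countable fun z : ℤ => ENNReal.ofReal (Real.exp (I.eps u / 4 * z))).comp hY
  have h2 := lintegral_exp_sum_netInput_le hX hM u hg hσt
  have h3 : ∀ ω, ENNReal.ofReal (Real.exp (I.eps u / 4 *
      (Y ω + (m - σ : ℕ) + ∑ l ∈ Finset.Ioc σ t, netInput I X u l ω : ℤ))) =
      ENNReal.ofReal (Real.exp (I.eps u / 4 * (m - σ : ℕ))) *
      (ENNReal.ofReal (Real.exp (I.eps u / 4 * Y ω)) * ENNReal.ofReal (Real.exp (I.eps u / 4 *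
        (∑ l ∈ Finset.Ioc σ t, netInput I X u l ω : ℤ)))) := by
    intro ω
    rw [← ENNReal.ofReal_mul (Real.exp_pos _).le, ← ENNReal.ofReal_mul (Real.exp_pos _).le,
      ← Real.exp_add, ← Real.exp_add, Int.cast_add, Int.cast_add, Int.cast_natCast]
    ring_nf
  rw [lintegral_congr h3, lintegral_const_mul' _ _ ENNReal.ofReal_ne_top] at h1
  rw [hYdef] at h1
  refine h1.trans ?_
  rw [← hYdef]
  refine (mul_le_mul' le_rfl (h2.trans (mul_le_mul' hYint le_rfl))).trans_eq ?_
  rw [← ENNReal.ofReal_mul hc, ← ENNReal.ofReal_mul (Real.exp_pos _).le, mul_left_comm,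
    ← Real.exp_add]
  congr 3
  ring

end NetInput

/-! ### Comparison with the optimal matching -/

section Comparison

variable {U K : ℕ} [NeZero K] {I : Instance U K} {𝓔 : Finset (Matching U K)}
  {proj : History U K → (Fin U → Fin K) → Matching U K} {ν : Measure (Fin U → ℕ × ℕ)}
  {Ω : Type*} {X : (i : Source U K) → Ω → i.Val}

lemma queue_succ (u : Fin U) (t : ℕ) (ω : Ω) :
    queue proj X u (t + 1) ω = step (queue proj X u t ω) (arrivalVar X (t + 1) u ω)
      (serviceVar X (t + 1) u (kappa proj X (t + 1) ω u) ω) := rfl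

/-- Exploitation in slot `l` schedules a matching other than the best one. -/
def wrongExploit (I : Instance U K) (proj : History U K → (Fin U → Fin K) → Matching U K)
    (X : (i : Source U K) → Ω → i.Val) (l : ℕ) : Set Ω :=
  {ω | exploreVar X l ω = false ∧ kappa proj X l ω ≠ I.best}

/-- From time `σ` to time `t` the arrivals to the queue of `u` exceed the services under the optimal
matching, when every exploration and every slot up to `m` costs one unit and, for `σ = 0`, the
initial length is added to the arrivals. -/
def longBusy (I : Instance U K) (X : (i : Source U K) → Ω → i.Val) (u : Fin U) (m t σ : ℕ) :
    Set Ω :=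
  {ω | 0 < (if σ = 0 then ((initVar X ω u).1 : ℤ) else 0) + (m - σ : ℕ) +
    ∑ l ∈ Finset.Ioc σ t, netInput I X u l ω}

/-- Unless exploitation went wrong after time `m` or the queue has been busy for `n` slots, the
queue exceeds the optimal one by no more than the number of explorations in the last `n` slots. -/
lemma queue_le_optimalQueue_add (u : Fin U) {m n t : ℕ} (hm : m ≤ t - n) {ω : Ω}
    (hW : ∀ l ∈ Finset.Ioc m t, ω ∉ wrongExploit I proj X l)
    (hF : ∀ σ ∈ Finset.range (t - n + 1), ω ∉ longBusy I X u m t σ) :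
    queue proj X u t ω ≤ optimalQueue I X u (fun ω => (initVar X ω u).1) t ω +
      ∑ l ∈ Finset.Ioc (t - n) t, (exploreVar X l ω).toNat := by
  let q : ℕ → ℕ := fun t => queue proj X u t ω
  let q' : ℕ → ℕ := fun t => optimalQueue I X u (fun ω => (initVar X ω u).1) t ω
  let a : ℕ → Bool := fun l => arrivalVar X l u ω
  let s : ℕ → Bool := fun l => serviceVar X l u (kappa proj X l ω u) ω
  let s' : ℕ → Bool := fun l => serviceVar X l u (I.best u) ω
  -- the slots with `b l = 0` are those that are known to be served by the best server
  let b : ℕ → ℕ := fun l => (if l ≤ m then 1 else 0) + (exploreVar X l ω).toNat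
  have hq : ∀ t, q (t + 1) = step (q t) (a (t + 1)) (s (t + 1)) := fun t => queue_succ u t ω
  have hq' : ∀ t, q' (t + 1) = step (q' t) (a (t + 1)) (s' (t + 1)) := fun t => rfl
  have hb : ∀ l ∈ Finset.Ioc 0 t, b l = 0 → s l = s' l := by
    intro l hl h0
    simp only [b, Nat.add_eq_zero_iff, ite_eq_right_iff, one_ne_zero, imp_false, not_le] at h0
    have hE : exploreVar X l ω = false := by
      cases h : exploreVar X l ω
      · rfl
      · rw [h] at h0; simp at h0
    have h1 := hW l (Finset.mem_Ioc.2 ⟨h0.1, (Finset.mem_Ioc.1 hl).2⟩)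
    have h2 : kappa proj X l ω = I.best := by
      by_contra hne
      exact h1 ⟨hE, hne⟩
    simp only [s, s', h2]
  rcases exists_empty_or_sum_pos (n := n) hq hb with ⟨σ, h1, h2, h3⟩ | ⟨σ, h1, h2⟩
  · have h4 := path_le_add_sum hq hq' (σ := σ) (t := t)
      (fun l hl => hb l (Finset.Ioc_subset_Ioc_left (Nat.zero_le _) hl)) h2 (by rw [h3]; simp)
    refine h4.trans (Nat.add_le_add_left ?_ _)
    calc ∑ l ∈ Finset.Ioc σ t, b l = ∑ l ∈ Finset.Ioc σ t, (exploreVar X l ω).toNat := by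
          refine Finset.sum_congr rfl fun l hl => ?_
          have := (Finset.mem_Ioc.1 hl).1
          simp [b, show ¬ l ≤ m by omega]
      _ ≤ _ := Finset.sum_le_sum_of_subset (Finset.Ioc_subset_Ioc_left h1)
  · exfalso
    refine hF σ (Finset.mem_range.2 (by omega)) ?_
    have h3 : ∑ l ∈ Finset.Ioc σ t, (((a l).toNat : ℤ) - (s' l).toNat + b l) =
        ∑ l ∈ Finset.Ioc σ t, netInput I X u l ω +
          ((∑ l ∈ Finset.Ioc σ t, if l ≤ m then 1 else 0 : ℕ) : ℤ) := by
      rw [Nat.cast_sum, ← Finset.sum_add_distrib]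
      refine Finset.sum_congr rfl fun l _ => ?_
      simp only [a, s', b, netInput]
      push_cast
      ring
    have h4 : (∑ l ∈ Finset.Ioc σ t, if l ≤ m then 1 else 0 : ℕ) ≤ m - σ := by
      rw [← Finset.card_filter, ← Nat.card_Ioc]
      refine Finset.card_le_card fun l hl => ?_
      simp only [Finset.mem_filter, Finset.mem_Ioc] at hl ⊢
      omega
    rw [h3] at h2
    have h5 : ((∑ l ∈ Finset.Ioc σ t, if l ≤ m then 1 else 0 : ℕ) : ℤ) ≤ (m - σ : ℕ) := by
      exact_mod_cast h4
    change (0 : ℤ) < _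
    change (0 : ℤ) < (if σ = 0 then ((initVar X ω u).1 : ℤ) else 0) + _ at h2
    linarith

/-- The crude bound used on the exceptional event. -/
lemma queue_le_optimalQueue_add_time (u : Fin U) (t : ℕ) (ω : Ω) :
    queue proj X u t ω ≤ optimalQueue I X u (fun ω => (initVar X ω u).1) t ω + t := by
  have h := path_le_add_sum (q := fun t => queue proj X u t ω)
    (q' := fun t => optimalQueue I X u (fun ω => (initVar X ω u).1) t ω)
    (a := fun l => arrivalVar X l u ω) (s := fun l => serviceVar X l u (kappa proj X l ω u) ω)
    (s' := fun l => serviceVar X l u (I.best u) ω) (b := fun _ => 1) (σ := 0) (t := t)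
    (fun t => queue_succ u t ω) (fun t => rfl) (by simp) (Nat.zero_le t) le_rfl
  simpa using h

lemma measurable_queue [MeasurableSpace Ω] (hX : ∀ i, Measurable (X i)) (u : Fin U) (t : ℕ) :
    Measurable (queue proj X u t) := by
  induction t with
  | zero =>
    exact (measurable_of_countable fun q : Fin U → ℕ × ℕ => (q u).1).comp (hX .init)
  | succ t ih =>
    have h1 : Measurable (arrivalVar X (t + 1) u) := hX _
    have h2 : Measurable fun ω => serviceVar X (t + 1) u (kappa proj X (t + 1) ω u) ω :=
      measurable_comp_countable (f := fun (κ : Matching U K) ω => serviceVar X (t + 1) u (κ u) ω)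
        (fun κ => hX (.service (t + 1) u (κ u))) (measurable_kappa fun i _ _ => hX i)
    exact (measurable_of_countable fun x : ℕ × Bool × Bool => step x.1 x.2.1 x.2.2).comp
      (ih.prodMk (h1.prodMk h2))

variable [MeasurableSpace Ω] {P : Measure Ω}

/-- The mean excess over the stationary mean: explorations in the last `n` slots, and the crude bound
`t` on the exceptional event. -/
lemma lintegral_queue_le [IsProbabilityMeasure P] (hX : ∀ i, Measurable (X i))
    (hM : IsModel I 𝓔 ν P X) {u : Fin U} {π : Measure ℕ}
    (hπ : IsStationary (I.lam u) (I.muStar u) π) (hf : ν.map (fun q => (q u).1) = π)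
    {m n t : ℕ} (hm : m ≤ t - n) :
    ∫⁻ ω, (queue proj X u t ω : ℝ≥0∞) ∂P ≤ ∫⁻ n : ℕ, (n : ℝ≥0∞) ∂π +
      ENNReal.ofReal (∑ l ∈ Finset.Ioc (t - n) t, (exploreProb K l : ℝ)) +
      t * (∑ l ∈ Finset.Ioc m t, P (wrongExploit I proj X l) +
        ∑ σ ∈ Finset.range (t - n + 1), P (longBusy I X u m t σ)) := by
  let B : Set Ω := (⋃ l ∈ Finset.Ioc m t, wrongExploit I proj X l) ∪
    ⋃ σ ∈ Finset.range (t - n + 1), longBusy I X u m t σ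
  let q' : Ω → ℕ := optimalQueue I X u (fun ω => (initVar X ω u).1) t
  have hpt : ∀ ω, (queue proj X u t ω : ℝ≥0∞) ≤ q' ω +
      ∑ l ∈ Finset.Ioc (t - n) t, ((exploreVar X l ω).toNat : ℝ≥0∞) +
        B.indicator (fun _ => (t : ℝ≥0∞)) ω := by
    intro ω
    by_cases hω : ω ∈ B
    · rw [indicator_of_mem hω]
      calc (queue proj X u t ω : ℝ≥0∞) ≤ q' ω + t := by
            exact_mod_cast queue_le_optimalQueue_add_time (I := I) u t ω
        _ ≤ _ := by
            gcongr
            exact le_self_add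
    · rw [indicator_of_notMem hω, add_zero]
      simp only [B, mem_union, mem_iUnion, not_or, not_exists] at hω
      exact_mod_cast queue_le_optimalQueue_add (I := I) u hm hω.1 hω.2
  have hq' : Measurable fun ω => (q' ω : ℝ≥0∞) :=
    (measurable_of_countable fun n : ℕ => (n : ℝ≥0∞)).comp
      (measurable_optimalQueue (fun i _ => hX i)
        ((measurable_of_countable fun q : Fin U → ℕ × ℕ => (q u).1).comp (hX .init)))
  have hEm : ∀ l, Measurable fun ω => ((exploreVar X l ω).toNat : ℝ≥0∞) := fun l =>
    (measurable_of_countable fun b : Bool => (b.toNat : ℝ≥0∞)).comp (hX (.explore l))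
  have hE : ∀ l, ∫⁻ ω, ((exploreVar X l ω).toNat : ℝ≥0∞) ∂P =
      ENNReal.ofReal (exploreProb K l) := by
    intro l
    rw [(hM.hasLaw_explore l).lintegral_comp (f := fun b : Bool => (b.toNat : ℝ≥0∞))
      (measurable_of_countable _).aemeasurable, lintegral_bernoulliLaw]
    simp
  have hB : P B ≤ ∑ l ∈ Finset.Ioc m t, P (wrongExploit I proj X l) +
      ∑ σ ∈ Finset.range (t - n + 1), P (longBusy I X u m t σ) :=
    (measure_union_le _ _).trans
      (add_le_add (measure_biUnion_finset_le _ _) (measure_biUnion_finset_le _ _))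
  have hqE : Measurable fun ω => (q' ω : ℝ≥0∞) +
      ∑ l ∈ Finset.Ioc (t - n) t, ((exploreVar X l ω).toNat : ℝ≥0∞) :=
    hq'.add (Finset.measurable_fun_sum _ fun l _ => hEm l)
  refine (lintegral_mono hpt).trans ?_
  rw [lintegral_add_left hqE,
    lintegral_add_left hq', lintegral_finsetSum _ fun l _ => hEm l]
  simp_rw [hE]
  rw [ENNReal.ofReal_sum_of_nonneg fun l _ => (exploreProb K l).2.1]
  gcongr
  · exact (lintegral_optimalQueue hX hM hπ hf t).le
  · exact (lintegral_indicator_const_le _ _).trans (mul_le_mul' le_rfl hB)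

end Comparison

/-! ### Exploration probabilities -/

section ExploreProb

/-- `log² x / x` is decreasing for `x ≥ exp 2`. -/
lemma log_sq_div_le {x y : ℝ} (hx : 8 ≤ x) (hxy : x ≤ y) :
    Real.log y ^ 2 / y ≤ Real.log x ^ 2 / x := by
  have h8 : Real.exp 2 ≤ 8 := by
    have h := Real.exp_one_lt_d9
    have h2 : Real.exp 2 = Real.exp 1 ^ 2 := by rw [← Real.exp_nat_mul]; norm_num
    rw [h2]
    nlinarith [Real.exp_pos 1]
  have h := Real.log_div_sqrt_antitoneOn (mem_Ici.2 (h8.trans hx))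
    (mem_Ici.2 (h8.trans (hx.trans hxy))) hxy
  have h0 : 0 ≤ Real.log y / √y := div_nonneg (Real.log_nonneg (by linarith)) (Real.sqrt_nonneg _)
  have h2 := pow_le_pow_left₀ h0 h 2
  simp only at h2
  rwa [div_pow, div_pow, Real.sq_sqrt (by linarith), Real.sq_sqrt (by linarith)] at h2

lemma exploreProb_le (K t : ℕ) : (exploreProb K t : ℝ) ≤ 3 * K * Real.log t ^ 2 / t :=
  min_le_right _ _

/-- When slot `j + 1` does not explore with certainty, every link has been explored at least
`log² (j + 1)` times on average, because the exploration probability is decreasing. -/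
lemma log_sq_le_sum_exploreProb {K j : ℕ} (hK : 0 < K) (hj : 15 ≤ j)
    (hp : (exploreProb K (j + 1) : ℝ) < 1) :
    Real.log (j + 1) ^ 2 ≤ ∑ i ∈ Finset.range j, (exploreProb K (i + 1) : ℝ) / K := by
  have hK' : (0 : ℝ) < K := by exact_mod_cast hK
  set L := Real.log ((j + 1 : ℕ) : ℝ) ^ 2 / ((j + 1 : ℕ) : ℝ) with hL
  have hL0 : 0 ≤ L := by positivity
  have hp' : 3 * K * L < 1 := by
    have : (exploreProb K (j + 1) : ℝ) = min 1 (3 * K * L) := by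
      rw [hL, ← mul_div_assoc]; rfl
    rw [this] at hp
    exact (min_lt_iff.1 hp).resolve_left (lt_irrefl _)
  -- the at least `(j + 1) / 2` slots from `8` to `j` lie in the range where `log² x / x` decreases
  have hterm : ∀ i ∈ Finset.Ico 7 j, 3 * L ≤ (exploreProb K (i + 1) : ℝ) / K := by
    intro i hi
    rw [Finset.mem_Ico] at hi
    rw [le_div_iff₀ hK']
    refine le_min (by linarith) ?_
    have h8 : (8 : ℝ) ≤ ((i + 1 : ℕ) : ℝ) := by exact_mod_cast (by omega : 8 ≤ i + 1)
    have hij : ((i + 1 : ℕ) : ℝ) ≤ ((j + 1 : ℕ) : ℝ) := by exact_mod_cast (by omega)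
    have := log_sq_div_le h8 hij
    rw [mul_div_assoc]
    calc 3 * L * K = 3 * K * L := by ring
      _ ≤ _ := by gcongr
  have h1 : ∑ i ∈ Finset.Ico 7 j, 3 * L ≤ ∑ i ∈ Finset.range j, (exploreProb K (i + 1) : ℝ) / K := by
    refine (Finset.sum_le_sum hterm).trans (Finset.sum_le_sum_of_subset_of_nonneg ?_ ?_)
    · intro i hi
      rw [Finset.mem_Ico] at hi
      exact Finset.mem_range.2 hi.2
    · intro i _ _
      exact div_nonneg (exploreProb K (i + 1)).2.1 hK'.le
  refine le_trans ?_ h1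
  rw [Finset.sum_const, Nat.card_Ico, nsmul_eq_mul, Nat.cast_sub (by omega)]
  have hj' : (15 : ℝ) ≤ j := by exact_mod_cast hj
  have h2 : Real.log (j + 1) ^ 2 = L * (j + 1) := by
    rw [hL]; push_cast; field_simp
  rw [h2]
  push_cast
  nlinarith

lemma sum_exploreProb_le {K σ t : ℕ} (hL : 1 ≤ Real.log t) :
    ∑ l ∈ Finset.Ioc σ t, (exploreProb K l : ℝ) ≤ 6 * K * Real.log t ^ 3 := by
  have hterm : ∀ l ∈ Finset.Icc 1 t, (exploreProb K l : ℝ) ≤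
      3 * K * Real.log t ^ 2 * ((l : ℝ))⁻¹ := by
    intro l hl
    rw [Finset.mem_Icc] at hl
    refine (exploreProb_le K l).trans ?_
    rw [div_eq_mul_inv]
    have h1 : (1 : ℝ) ≤ l := by exact_mod_cast hl.1
    have h2 : (l : ℝ) ≤ t := by exact_mod_cast hl.2
    have := Real.log_nonneg h1
    have := Real.log_le_log (by linarith) h2
    gcongr
  have hsub : Finset.Ioc σ t ⊆ Finset.Icc 1 t := fun l hl => by
    rw [Finset.mem_Ioc] at hl
    exact Finset.mem_Icc.2 ⟨by omega, hl.2⟩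
  have hharm : ∑ l ∈ Finset.Icc 1 t, ((l : ℝ))⁻¹ ≤ 1 + Real.log t := by
    have h := harmonic_le_one_add_log t
    rw [harmonic_eq_sum_Icc] at h
    push_cast at h
    exact h
  calc ∑ l ∈ Finset.Ioc σ t, (exploreProb K l : ℝ)
      ≤ ∑ l ∈ Finset.Icc 1 t, (exploreProb K l : ℝ) :=
        Finset.sum_le_sum_of_subset_of_nonneg hsub fun l _ _ => (exploreProb K l).2.1
    _ ≤ ∑ l ∈ Finset.Icc 1 t, 3 * K * Real.log t ^ 2 * ((l : ℝ))⁻¹ := Finset.sum_le_sum hterm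
    _ = 3 * K * Real.log t ^ 2 * ∑ l ∈ Finset.Icc 1 t, ((l : ℝ))⁻¹ := by rw [Finset.mul_sum]
    _ ≤ 3 * K * Real.log t ^ 2 * (2 * Real.log t) := by gcongr; linarith
    _ = _ := by ring

lemma exploreProb_le_of_half_le {K l t : ℕ} (h1 : (t : ℝ) / 2 ≤ l) (h2 : l ≤ t) (ht : 2 ≤ t) :
    (exploreProb K l : ℝ) ≤ 6 * K * Real.log t ^ 2 / t := by
  have ht' : (2 : ℝ) ≤ t := by exact_mod_cast ht
  have h2' : (l : ℝ) ≤ t := by exact_mod_cast h2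
  have hl1 : (1 : ℝ) ≤ l := by linarith
  refine (exploreProb_le K l).trans ?_
  have := Real.log_nonneg hl1
  have := Real.log_le_log (by linarith) h2'
  calc 3 * K * Real.log l ^ 2 / l ≤ 3 * K * Real.log t ^ 2 / (t / 2) := by gcongr
    _ = _ := by rw [div_div_eq_mul_div]; ring

end ExploreProb

/-! ### Growth of the function `w` -/

section Growth

lemma eventually_mul_pow_three_le_exp {Δ : ℝ} (hΔ : 0 < Δ) (c : ℝ) :
    ∀ᶠ L : ℝ in atTop, c * L ^ 3 ≤ Real.exp ((2 * L / Δ) ^ (2 / 3 : ℝ)) := by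
  have hlin : Tendsto (fun L : ℝ => 2 * L / Δ) atTop atTop :=
    (tendsto_id.const_mul_atTop two_pos).atTop_div_const hΔ
  have ht : Tendsto (fun L : ℝ => (2 * L / Δ) ^ (2 / 3 : ℝ)) atTop atTop :=
    (tendsto_rpow_atTop (by norm_num)).comp hlin
  -- `L ^ 3` is a multiple of the power `9 / 2` of the exponent
  have hc : 0 < 1 / ((|c| + 1) * (Δ / 2) ^ 3) := by positivity
  have h := ht.eventually ((isLittleO_rpow_exp_atTop (9 / 2)).def hc)
  filter_upwards [h, eventually_ge_atTop 0] with L hL hL0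
  have hx : 0 ≤ 2 * L / Δ := by positivity
  rw [← Real.rpow_mul hx, Real.norm_of_nonneg (by positivity),
    Real.norm_of_nonneg (Real.exp_pos _).le,
    show (2 / 3 : ℝ) * (9 / 2) = (3 : ℕ) by norm_num, Real.rpow_natCast] at hL
  have h2 : (|c| + 1) * (Δ / 2) ^ 3 * (2 * L / Δ) ^ 3 ≤ Real.exp ((2 * L / Δ) ^ (2 / 3 : ℝ)) := by
    have := mul_le_mul_of_nonneg_left hL (a := (|c| + 1) * (Δ / 2) ^ 3) (by positivity)
    refine this.trans_eq ?_
    field_simp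
  have h3 : (|c| + 1) * (Δ / 2) ^ 3 * (2 * L / Δ) ^ 3 = (|c| + 1) * L ^ 3 := by
    field_simp
  rw [h3] at h2
  refine le_trans ?_ h2
  gcongr
  linarith [le_abs_self c]

/-- `(2 * L / Δ) ^ (4 / 3)` grows faster than linearly in `L`. -/
lemma eventually_const_mul_exp_le {Δ : ℝ} (hΔ : 0 < Δ) {c : ℝ} (hc : 0 < c) (A : ℝ) :
    ∀ᶠ L : ℝ in atTop,
      A * Real.exp (-(c * (2 * L / Δ) ^ (4 / 3 : ℝ))) ≤ Real.exp (-(5 * L)) := by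
  have hlin : Tendsto (fun L : ℝ => 2 * L / Δ) atTop atTop :=
    (tendsto_id.const_mul_atTop two_pos).atTop_div_const hΔ
  have ht : Tendsto (fun L : ℝ => c * (2 / Δ) * (2 * L / Δ) ^ (1 / 3 : ℝ)) atTop atTop :=
    ((tendsto_rpow_atTop (by norm_num)).comp hlin).const_mul_atTop (by positivity)
  filter_upwards [ht.eventually_ge_atTop 6, Real.tendsto_exp_atTop.eventually_ge_atTop A,
    eventually_gt_atTop 0] with L h1 h2 h0
  have hx : 0 < 2 * L / Δ := by positivity
  have h3 : 6 * L ≤ c * (2 * L / Δ) ^ (4 / 3 : ℝ) := by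
    rw [show (4 / 3 : ℝ) = 1 + 1 / 3 by norm_num, Real.rpow_add hx, Real.rpow_one]
    calc 6 * L ≤ (c * (2 / Δ) * (2 * L / Δ) ^ (1 / 3 : ℝ)) * L := by gcongr
      _ = _ := by ring
  calc A * Real.exp (-(c * (2 * L / Δ) ^ (4 / 3 : ℝ))) ≤ Real.exp L * Real.exp (-(6 * L)) := by
        gcongr
    _ = _ := by rw [← Real.exp_add]; ring_nf

/-- The lower bounds on `w` that hold for all times beyond a threshold depending on `Δ` alone: `w`
outgrows every power of `log t`, and `log² w`, the expected number of explorations of a link at time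
`w`, outgrows every multiple of `log t`. -/
lemma eventually_growth {Δ : ℝ} (hΔ : 0 < Δ) :
    ∃ t₀ : ℝ, ∀ t : ℝ, t₀ < t → 10 ≤ Real.log t ∧ 1000 * Real.log t ^ 3 ≤ w Δ t ∧
      64 / Δ ^ 2 * Real.exp (-((1 - Real.exp (-(Δ ^ 2 / 64))) *
        (2 * Real.log t / Δ) ^ (4 / 3 : ℝ))) ≤ Real.exp (-(5 * Real.log t)) := by
  have hc : 0 < 1 - Real.exp (-(Δ ^ 2 / 64)) := by
    rw [sub_pos, Real.exp_lt_one_iff, neg_lt_zero]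
    positivity
  have h := Real.tendsto_log_atTop.eventually ((eventually_ge_atTop 10).and
    ((eventually_mul_pow_three_le_exp hΔ 1000).and
      (eventually_const_mul_exp_le hΔ hc (64 / Δ ^ 2))))
  obtain ⟨t₀, ht₀⟩ := eventually_atTop.1 h
  exact ⟨t₀, fun t ht => ht₀ t ht.le⟩

end Growth

/-! ### The regret -/

section Congr

variable {U K : ℕ} {Ω : Type*} {X Y : (i : Source U K) → Ω → i.Val} {ω : Ω}

/-- The optimal queue depends on the sources of randomness only through their values at `ω`. -/
lemma queueStar_eq_const (I : Instance U K) (u : Fin U) (t : ℕ) :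
    queueStar I X u t ω = queueStar I (fun i (_ : Unit) => X i ω) u t () := by
  induction t with
  | zero => rfl
  | succ t ih =>
    exact congrArg (fun q => step q (arrivalVar X (t + 1) u ω)
      (serviceVar X (t + 1) u (I.best u) ω)) ih

lemma queueStar_congr (I : Instance U K) (h : ∀ i, X i ω = Y i ω) (u : Fin U) (t : ℕ) :
    queueStar I X u t ω = queueStar I Y u t ω := by
  rw [queueStar_eq_const, queueStar_eq_const (X := Y)]
  simp only [h]

variable [NeZero K] {proj : History U K → (Fin U → Fin K) → Matching U K}

/-- The history depends on the sources of randomness only through their values at `ω`. -/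
lemma history_eq_const (t : ℕ) :
    history proj X t ω = history proj (fun i (_ : Unit) => X i ω) t () := by
  induction t with
  | zero => rfl
  | succ t ih =>
    exact congrArg (fun h : History U K => ((schedule proj X (t + 1) h ω,
      fun u => serviceVar X (t + 1) u (schedule proj X (t + 1) h ω u) ω) :: h : History U K)) ih

lemma kappa_succ_eq_const (t : ℕ) :
    kappa proj X (t + 1) ω = kappa proj (fun i (_ : Unit) => X i ω) (t + 1) () :=
  congrArg (fun h : History U K => schedule proj X (t + 1) h ω) (history_eq_const t)

lemma queue_eq_const (u : Fin U) (t : ℕ) :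
    queue proj X u t ω = queue proj (fun i (_ : Unit) => X i ω) u t () := by
  induction t with
  | zero => rfl
  | succ t ih =>
    exact congrArg₂ (fun q (κ : Matching U K) => step q (arrivalVar X (t + 1) u ω)
      (serviceVar X (t + 1) u (κ u) ω)) ih (kappa_succ_eq_const t)

lemma queue_congr (h : ∀ i, X i ω = Y i ω) (u : Fin U) (t : ℕ) :
    queue proj X u t ω = queue proj Y u t ω := by
  rw [queue_eq_const, queue_eq_const (X := Y)]
  simp only [h]

end Congr

section Regret

variable {U K : ℕ} {I : Instance U K} {𝓔 : Finset (Matching U K)}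
  {proj : History U K → (Fin U → Fin K) → Matching U K} {ν : Measure (Fin U → ℕ × ℕ)}
  {Ω : Type*} {X : (i : Source U K) → Ω → i.Val} [MeasurableSpace Ω] {P : Measure Ω}

/-- If less than half of the time has passed before `σ`, then the services outweigh the unit costs
of the first `m` slots and of all explorations, which together are of the order `K * w Δ t`.
Otherwise only the few explorations in the second half of the time matter. -/
lemma measure_longBusy_le [IsProbabilityMeasure P] (hX : ∀ i, Measurable (X i))
    (hM : IsModel I 𝓔 ν P X) {u : Fin U} {π : Measure ℕ}
    (hπ : IsStationary (I.lam u) (I.muStar u) π) (hf : ν.map (fun q => (q u).1) = π)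
    {W : ℝ} {m n t σ : ℕ} (hK : 2 ≤ K) (hL : 10 ≤ Real.log t) (hw : 1000 * Real.log t ^ 3 ≤ W)
    (hεw : 2 * Real.log t ≤ I.eps u * W) (ht : 12 * K * W ≤ I.eps u * t) (hm : (m : ℝ) ≤ W + 1)
    (hmt : 2 * m ≤ t) (hn : 24 / I.eps u ^ 2 * Real.log t - 1 ≤ n) (hnt : n ≤ t)
    (hσ : σ ≤ t - n) :
    P (longBusy I X u m t σ) ≤ ENNReal.ofReal (Real.exp (-(3 * Real.log t))) := by
  have hσt : σ ≤ t := hσ.trans (Nat.sub_le _ _)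
  refine (measure_sum_pos_le hX hM hπ hf hσt m).trans (ENNReal.ofReal_le_ofReal ?_)
  have hε0 := eps_pos I u
  have hε1 := eps_le_one I u
  set ε := I.eps u
  set L := Real.log t with hLdef
  have ht0 : (0 : ℝ) < t := by
    by_contra h
    have : (t : ℝ) = 0 := le_antisymm (not_lt.1 h) (Nat.cast_nonneg t)
    rw [hLdef, this, Real.log_zero] at hL
    linarith
  have ht2 : 2 ≤ t := by
    by_contra h
    have : (t : ℝ) ≤ 1 := by exact_mod_cast (by omega : t ≤ 1)
    have := Real.log_nonpos ht0.le this
    linarith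
  have hK2 : (2 : ℝ) ≤ K := by exact_mod_cast hK
  have hL3 : 1000 ≤ L ^ 3 := by
    calc (1000 : ℝ) = 10 ^ 3 := by norm_num
      _ ≤ L ^ 3 := by gcongr
  have hW0 : 1000000 ≤ W := by linarith
  have hεW : 0 < ε * W := by positivity
  have hZ : 2 * (ε * W) ≤ ε * W * K := by nlinarith
  have hσt' : (σ : ℝ) ≤ t := by exact_mod_cast hσt
  rcases lt_or_ge (2 * σ) t with h2 | h2
  · have hS : 0.3 * ε * ∑ l ∈ Finset.Ioc σ t, (exploreProb K l : ℝ) ≤ 0.0018 * (ε * W * K) := by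
      have h := sum_exploreProb_le (K := K) (σ := σ) (t := t) (by linarith)
      calc 0.3 * ε * ∑ l ∈ Finset.Ioc σ t, (exploreProb K l : ℝ) ≤ 0.3 * ε * (6 * K * L ^ 3) := by
            gcongr
        _ = 0.0018 * (ε * (1000 * L ^ 3) * K) := by ring
        _ ≤ _ := by gcongr
    have hN : ε / 4 * ((m - σ : ℕ) : ℝ) ≤ 0.13 * (ε * W * K) := by
      have h3 : ((m - σ : ℕ) : ℝ) ≤ m := by exact_mod_cast Nat.sub_le _ _
      have h4 : ε * ((m - σ : ℕ) : ℝ) ≤ ε * (1.01 * W) := by gcongr; linarith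
      linarith
    have hD : 12 * (ε * W * K) ≤ ε ^ 2 * t := by
      have := mul_le_mul_of_nonneg_left ht hε0.le
      nlinarith
    split_ifs with h0
    · -- the mean `3 / ε` of the exponential of the initial length is at most `t`
      have h3 : 3 / ε ≤ Real.exp L := by
        rw [Real.exp_log ht0, div_le_iff₀ hε0]
        nlinarith
      rw [h0]
      calc 3 / ε * _ ≤ Real.exp L * Real.exp (-(4 * L)) := by
            refine mul_le_mul h3 (Real.exp_le_exp.2 ?_) (Real.exp_pos _).le (Real.exp_pos _).le
            rw [h0] at hN hS
            push_cast
            nlinarith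
        _ = _ := by rw [← Real.exp_add]; ring_nf
    · rw [one_mul]
      refine Real.exp_le_exp.2 ?_
      have h3 : (t : ℝ) / 2 ≤ t - σ := by
        have : (2 * σ : ℝ) ≤ t := by exact_mod_cast h2.le
        linarith
      have h4 : ε ^ 2 * (t / 2) ≤ ε ^ 2 * (t - σ) := by gcongr
      nlinarith
  · -- no slot up to `m` is left after `σ`, and the exploration probabilities are far below `ε`, so
    -- that the drift over the at least `n` slots gives `exp (-0.17 * 24 * log t)`
    have hm0 : m - σ = 0 := by omega
    have hσ0 : σ ≠ 0 := by omega
    have hp : 6 * K * L ^ 2 / t ≤ ε / 20000 := by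
      rw [div_le_iff₀ ht0]
      have h3 : 10000 * L ^ 2 ≤ W := by nlinarith [sq_nonneg L]
      have h4 : 12 * K * (10000 * L ^ 2) ≤ 12 * K * W := by gcongr
      linarith
    have hS : ∑ l ∈ Finset.Ioc σ t, (exploreProb K l : ℝ) ≤ (t - σ) * (ε / 20000) := by
      refine (Finset.sum_le_card_nsmul _ _ (ε / 20000) fun l hl => ?_).trans_eq ?_
      · rw [Finset.mem_Ioc] at hl
        refine (exploreProb_le_of_half_le ?_ hl.2 ht2).trans hp
        have : (t : ℝ) ≤ 2 * l := by exact_mod_cast (by omega : t ≤ 2 * l)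
        linarith
      · rw [Nat.card_Ioc, nsmul_eq_mul, Nat.cast_sub hσt]
    rw [if_neg hσ0, hm0, one_mul]
    refine Real.exp_le_exp.2 ?_
    have h3 : 0.3 * ε * ∑ l ∈ Finset.Ioc σ t, (exploreProb K l : ℝ) ≤
        0.3 * ε * ((t - σ) * (ε / 20000)) := by gcongr
    have hnσ : (n : ℝ) ≤ t - σ := by
      have : (n + σ : ℕ) ≤ t := by omega
      have : ((n + σ : ℕ) : ℝ) ≤ t := by exact_mod_cast this
      push_cast at this
      linarith
    have h4 : ε ^ 2 * (24 / ε ^ 2 * L - 1) ≤ ε ^ 2 * (t - σ) := by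
      refine mul_le_mul_of_nonneg_left ?_ (by positivity)
      linarith
    have h5 : ε ^ 2 * (24 / ε ^ 2 * L - 1) = 24 * L - ε ^ 2 := by field_simp
    have h6 : ε ^ 2 ≤ 1 := by nlinarith
    rw [h5] at h4
    push_cast
    nlinarith

/-- The almost everywhere measurable sources can be replaced by measurable ones, since there are
only countably many of them. -/
lemma IsModel.exists_measurable (hM : IsModel I 𝓔 ν P X) :
    ∃ Y : (i : Source U K) → Ω → i.Val, (∀ i, Measurable (Y i)) ∧ IsModel I 𝓔 ν P Y ∧
      ∀ᵐ ω ∂P, ∀ i, X i ω = Y i ω := by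
  refine ⟨fun i => (hM.law i).aemeasurable.mk (X i), fun i => (hM.law i).aemeasurable.measurable_mk,
    ⟨hM.indep.congr fun i => (hM.law i).aemeasurable.ae_eq_mk,
      fun i => (hM.law i).congr (hM.law i).aemeasurable.ae_eq_mk.symm⟩, ?_⟩
  exact ae_all_iff.2 fun i => (hM.law i).aemeasurable.ae_eq_mk

variable [NeZero K]

/-- After time `w Δ t` exploitation errs with probability at most `t⁻³`: by then every link has been
explored `log² (w Δ t) = (2 * log t / Δ) ^ (4 / 3)` times on average, unless exploration is still
certain, in which case there is no exploitation. -/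
lemma measure_wrongExploit_le [IsProbabilityMeasure P] (hX : ∀ i, Measurable (X i))
    (hM : IsModel I 𝓔 ν P X) (h𝓔 : IsExploreSet 𝓔) (hproj : IsProjection proj) {Δ : ℝ}
    (hΔ0 : 0 < Δ) (hΔ1 : Δ ≤ 1) (hΔ : ∀ u k, k ≠ I.best u → Δ ≤ (I.mu u (I.best u) : ℝ) - I.mu u k)
    {t : ℕ} (hL : 10 ≤ Real.log t) (hw : 1000 * Real.log t ^ 3 ≤ w Δ t)
    (hexp : 64 / Δ ^ 2 * Real.exp (-((1 - Real.exp (-(Δ ^ 2 / 64))) *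
        (2 * Real.log t / Δ) ^ (4 / 3 : ℝ))) ≤ Real.exp (-(5 * Real.log t)))
    (hKt : (K : ℝ) ≤ t) {j : ℕ} (hj : w Δ t ≤ j) :
    P (wrongExploit I proj X (j + 1)) ≤ ENNReal.ofReal (Real.exp (-(3 * Real.log t))) := by
  rcases (exploreProb K (j + 1)).2.2.lt_or_eq with hp | hp
  · refine (measure_exploit_ne_best_le hX hM h𝓔 hproj hΔ0 hΔ1 hΔ j).trans
      (ENNReal.ofReal_le_ofReal ?_)
    have hUK : (U : ℝ) ≤ K := by
      have := Fintype.card_le_of_embedding I.best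
      simp only [Fintype.card_fin] at this
      exact_mod_cast this
    have ht0 : (0 : ℝ) < t := lt_of_lt_of_le
      (by exact_mod_cast Nat.pos_of_ne_zero (NeZero.ne K)) hKt
    have hc : 0 < 1 - Real.exp (-(Δ ^ 2 / 64)) := by
      rw [sub_pos, Real.exp_lt_one_iff, neg_lt_zero]
      positivity
    have hw0 : 0 < w Δ t := Real.exp_pos _
    have hj15 : 15 ≤ j := by
      have h3 : (10 : ℝ) ^ 3 ≤ Real.log t ^ 3 := by gcongr
      have : (15 : ℝ) ≤ j := by linarith
      exact_mod_cast this
    have hsum := log_sq_le_sum_exploreProb (Nat.pos_of_ne_zero (NeZero.ne K)) hj15 hp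
    have hx : 0 ≤ 2 * Real.log t / Δ := by positivity
    have hlog : (2 * Real.log t / Δ) ^ (4 / 3 : ℝ) ≤ Real.log (j + 1) ^ 2 := by
      have h1 : (2 * Real.log t / Δ) ^ (2 / 3 : ℝ) ≤ Real.log (j + 1) := by
        rw [Real.le_log_iff_exp_le (by positivity)]
        exact hj.trans (by linarith)
      calc (2 * Real.log t / Δ) ^ (4 / 3 : ℝ) = ((2 * Real.log t / Δ) ^ (2 / 3 : ℝ)) ^ 2 := by
            rw [← Real.rpow_natCast, ← Real.rpow_mul hx]; norm_num
        _ ≤ _ := pow_le_pow_left₀ (by positivity) h1 2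
    have het : (t : ℝ) = Real.exp (Real.log t) := (Real.exp_log ht0).symm
    -- `U * K ≤ t ^ 2`, which turns `t⁻⁵` into `t⁻³`
    calc (U * K * (64 / Δ ^ 2 * Real.exp (-((1 - Real.exp (-(Δ ^ 2 / 64))) *
          ∑ j ∈ Finset.range j, (exploreProb K (j + 1) : ℝ) / K))) : ℝ)
        ≤ t * t * (64 / Δ ^ 2 * Real.exp (-((1 - Real.exp (-(Δ ^ 2 / 64))) *
          (2 * Real.log t / Δ) ^ (4 / 3 : ℝ)))) := by
          gcongr
          · exact_mod_cast hUK.trans hKt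
          · exact hlog.trans hsum
      _ ≤ t * t * Real.exp (-(5 * Real.log t)) := by gcongr
      _ = Real.exp (-(3 * Real.log t)) := by
          conv_lhs => rw [het]
          rw [← Real.exp_add, ← Real.exp_add, Real.log_exp]
          ring_nf
  · have h0 : P {ω | exploreVar X (j + 1) ω = false} = 0 := by
      rw [(hM.hasLaw_explore (j + 1)).measure_eq (p := fun b => b = false) .of_discrete,
        ← lintegral_indicator_one .of_discrete, lintegral_bernoulliLaw]
      simp [hp]
    exact (measure_mono_null (fun ω hω => hω.1) h0).trans_le zero_le

lemma integrable_natCast_of_lintegral_lt_top {q : Ω → ℕ} (hq : Measurable q)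
    (h : ∫⁻ ω, (q ω : ℝ≥0∞) ∂P < ∞) :
    Integrable (fun ω => (q ω : ℝ)) P ∧ ∫ ω, (q ω : ℝ) ∂P = (∫⁻ ω, (q ω : ℝ≥0∞) ∂P).toReal := by
  have hm : Measurable fun ω => (q ω : ℝ≥0∞) :=
    (measurable_of_countable fun n : ℕ => (n : ℝ≥0∞)).comp hq
  refine ⟨by simpa using integrable_toReal_of_lintegral_ne_top hm.aemeasurable h.ne, ?_⟩
  simpa using integral_toReal (μ := P) hm.aemeasurable (.of_forall fun ω => ENNReal.natCast_lt_top _)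

/-- Both families of exceptional events consist of at most `t` events of probability at most `t⁻³`,
and the explorations of the last `24 / ε² * log t` slots form the main term. -/
lemma lintegral_queue_le_of_growth [IsProbabilityMeasure P] (hX : ∀ i, Measurable (X i))
    (hM : IsModel I 𝓔 ν P X) (h𝓔 : IsExploreSet 𝓔) (hproj : IsProjection proj) {Δ : ℝ}
    (hΔ0 : 0 < Δ) (hΔ1 : Δ ≤ 1) (hΔ : ∀ u k, k ≠ I.best u → Δ ≤ (I.mu u (I.best u) : ℝ) - I.mu u k)
    {u : Fin U} {π : Measure ℕ} (hπ : IsStationary (I.lam u) (I.muStar u) π)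
    (hf : ν.map (fun q => (q u).1) = π) {t : ℕ} (hK : 2 ≤ K) (hL : 10 ≤ Real.log t)
    (hw : 1000 * Real.log t ^ 3 ≤ w Δ t)
    (hexp : 64 / Δ ^ 2 * Real.exp (-((1 - Real.exp (-(Δ ^ 2 / 64))) *
        (2 * Real.log t / Δ) ^ (4 / 3 : ℝ))) ≤ Real.exp (-(5 * Real.log t)))
    (hεw : 2 * Real.log t ≤ I.eps u * w Δ t) (ht : 12 * K * w Δ t ≤ I.eps u * t)
    (hεt : 24 / I.eps u ^ 2 * Real.log t ≤ t / 2) :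
    ∫⁻ ω, (queue proj X u t ω : ℝ≥0∞) ∂P ≤ ∫⁻ n : ℕ, (n : ℝ≥0∞) ∂π +
      ENNReal.ofReal (24 / I.eps u ^ 2 * Real.log t * (6 * K * Real.log t ^ 2 / t) +
        t * (t * Real.exp (-(3 * Real.log t)) + t * Real.exp (-(3 * Real.log t)))) := by
  have hε0 := eps_pos I u
  have hε1 := eps_le_one I u
  set ε := I.eps u
  set L := Real.log t with hLdef
  set W := w Δ t
  have hK2 : (2 : ℝ) ≤ K := by exact_mod_cast hK
  have hL3 : 1000 ≤ L ^ 3 := by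
    calc (1000 : ℝ) = 10 ^ 3 := by norm_num
      _ ≤ L ^ 3 := by gcongr
  have hW0 : 1000000 ≤ W := by linarith
  have hKWt : 12 * K * W ≤ t := ht.trans (mul_le_of_le_one_left (Nat.cast_nonneg t) hε1)
  have hKt : (K : ℝ) ≤ t := by nlinarith
  have h24 : 24 ≤ 24 / ε ^ 2 * L - 1 := by
    have h1 : ε ^ 2 ≤ 1 := by nlinarith
    have h2 : (24 : ℝ) ≤ 24 / ε ^ 2 := by rw [le_div_iff₀ (by positivity)]; linarith
    nlinarith
  -- `n` is the length of the window within which the queue is empty at some time; exploitation is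
  -- trusted after slot `m`
  obtain ⟨n, hn⟩ : ∃ n, n = ⌊24 / ε ^ 2 * L⌋₊ := ⟨_, rfl⟩
  obtain ⟨m, hm⟩ : ∃ m, m = ⌈W⌉₊ := ⟨_, rfl⟩
  have hnv : (n : ℝ) ≤ 24 / ε ^ 2 * L := hn ▸ Nat.floor_le (by positivity)
  have hn1 : 24 / ε ^ 2 * L - 1 ≤ n := by
    have := Nat.lt_floor_add_one (24 / ε ^ 2 * L)
    rw [hn]
    linarith
  have hWm : W ≤ m := hm ▸ Nat.le_ceil W
  have hmW : (m : ℝ) ≤ W + 1 := hm ▸ (Nat.ceil_lt_add_one (by linarith)).le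
  have hmt : 2 * m ≤ t := by
    have h12 : 24 * W ≤ 12 * K * W := by nlinarith
    have : (2 * m : ℝ) ≤ t := by linarith
    exact_mod_cast this
  have hnt : 2 * n ≤ t := by
    have : (2 * n : ℝ) ≤ t := by linarith
    exact_mod_cast this
  have hn_pos : 1 ≤ n := by
    have : (1 : ℝ) ≤ n := by linarith
    exact_mod_cast this
  have ht2 : 2 ≤ t := by omega
  set E := ENNReal.ofReal (Real.exp (-(3 * L))) with hE
  have hsumW : ∑ l ∈ Finset.Ioc m t, P (wrongExploit I proj X l) ≤ t * E := by
    refine (Finset.sum_le_card_nsmul _ _ E fun l hl => ?_).trans ?_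
    · rw [Finset.mem_Ioc] at hl
      obtain ⟨j, rfl⟩ : ∃ j, l = j + 1 := ⟨l - 1, by omega⟩
      refine measure_wrongExploit_le hX hM h𝓔 hproj hΔ0 hΔ1 hΔ hL hw hexp hKt (hWm.trans ?_)
      exact_mod_cast (by omega : m ≤ j)
    · rw [Nat.card_Ioc, nsmul_eq_mul]
      exact mul_le_mul' (Nat.cast_le.2 (Nat.sub_le _ _)) le_rfl
  have hsumF : ∑ σ ∈ Finset.range (t - n + 1), P (longBusy I X u m t σ) ≤ t * E := by
    refine (Finset.sum_le_card_nsmul _ _ E fun σ hσ => ?_).trans ?_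
    · rw [Finset.mem_range] at hσ
      exact measure_longBusy_le hX hM hπ hf hK hL hw hεw ht hmW hmt hn1 (by omega) (by omega)
    · rw [Finset.card_range, nsmul_eq_mul]
      exact mul_le_mul' (Nat.cast_le.2 (by omega)) le_rfl
  have hsumE : ∑ l ∈ Finset.Ioc (t - n) t, (exploreProb K l : ℝ) ≤
      24 / ε ^ 2 * L * (6 * K * L ^ 2 / t) := by
    refine (Finset.sum_le_card_nsmul _ _ (6 * K * L ^ 2 / t) fun l hl => ?_).trans ?_
    · rw [Finset.mem_Ioc] at hl
      refine exploreProb_le_of_half_le ?_ hl.2 ht2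
      have : (t : ℝ) ≤ 2 * l := by exact_mod_cast (by omega : t ≤ 2 * l)
      linarith
    · rw [Nat.card_Ioc, nsmul_eq_mul, Nat.sub_sub_self (by omega)]
      exact mul_le_mul_of_nonneg_right hnv (by positivity)
  refine (lintegral_queue_le (n := n) hX hM hπ hf (by omega : m ≤ t - n)).trans ?_
  rw [ENNReal.ofReal_add (by positivity) (by positivity), ← add_assoc,
    ENNReal.ofReal_mul (Nat.cast_nonneg t), ENNReal.ofReal_add (by positivity) (by positivity),
    ENNReal.ofReal_mul (Nat.cast_nonneg t), ENNReal.ofReal_natCast, ← hE]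
  exact add_le_add (add_le_add le_rfl (ENNReal.ofReal_le_ofReal hsumE))
    (mul_le_mul' le_rfl (add_le_add hsumW hsumF))

/-- The bound on the queue-regret when all sources of randomness are measurable, as opposed to
almost everywhere measurable. -/
lemma regret_le_of_measurable [IsProbabilityMeasure P] (hX : ∀ i, Measurable (X i))
    (hM : IsModel I 𝓔 ν P X) (h𝓔 : IsExploreSet 𝓔) (hproj : IsProjection proj)
    (hν : IsInitialLaw I ν) {Δ : ℝ}
    (hΔ0 : 0 < Δ) (hΔ1 : Δ ≤ 1) (hΔ : ∀ u k, k ≠ I.best u → Δ ≤ (I.mu u (I.best u) : ℝ) - I.mu u k)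
    {u : Fin U} {t : ℕ} (hK : 2 ≤ K) (hL : 10 ≤ Real.log t) (hw : 1000 * Real.log t ^ 3 ≤ w Δ t)
    (hexp : 64 / Δ ^ 2 * Real.exp (-((1 - Real.exp (-(Δ ^ 2 / 64))) *
        (2 * Real.log t / Δ) ^ (4 / 3 : ℝ))) ≤ Real.exp (-(5 * Real.log t)))
    (hεw : 2 / I.eps u ≤ w Δ t / Real.log t)
    (hv : v K Δ (I.eps u) t + v' K Δ (I.eps u) t ≤ (t : ℝ) / 2) :
    Integrable (fun ω => (queue proj X u t ω : ℝ)) P ∧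
      Integrable (fun ω => (queueStar I X u t ω : ℝ)) P ∧
      regret proj X P I u t ≤ 8 * (K * v K Δ (I.eps u) t * Real.log t ^ 2 / t) := by
  obtain ⟨π, hπ, hf1, hf2⟩ := hν u
  have hε0 := eps_pos I u
  have hε1 := eps_le_one I u
  have hw0 : 0 < w Δ t := Real.exp_pos _
  have hK2 : (2 : ℝ) ≤ K := by exact_mod_cast hK
  have hv'0 : 0 ≤ v' K Δ (I.eps u) t := by simp only [v']; positivity
  have hv0 : 24 / I.eps u ^ 2 * Real.log t ≤ v K Δ (I.eps u) t :=
    le_add_of_nonneg_right (by positivity)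
  have h24 : 24 * Real.log t ≤ 24 / I.eps u ^ 2 * Real.log t := by
    have h1 : I.eps u ^ 2 ≤ 1 := by nlinarith
    have h2 : (24 : ℝ) ≤ 24 / I.eps u ^ 2 := by rw [le_div_iff₀ (by positivity)]; linarith
    exact mul_le_mul_of_nonneg_right h2 (by linarith)
  have hKW : 6 * K / I.eps u * w Δ t ≤ t / 2 := by
    have : v' K Δ (I.eps u) t = 6 * K / I.eps u * w Δ t := rfl
    linarith
  have ht : 12 * K * w Δ t ≤ I.eps u * t := by
    have := mul_le_mul_of_nonneg_left hKW hε0.le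
    have h2 : I.eps u * (6 * K / I.eps u * w Δ t) = 6 * K * w Δ t := by field_simp
    linarith
  have ht0 : (0 : ℝ) < t := by
    have : 0 < 12 * K * w Δ t := by positivity
    by_contra h
    nlinarith
  have hεw' : 2 * Real.log t ≤ I.eps u * w Δ t := by
    rw [div_le_div_iff₀ hε0 (by linarith)] at hεw
    linarith
  have hmain := lintegral_queue_le_of_growth (proj := proj) hX hM h𝓔 hproj hΔ0 hΔ1 hΔ hπ hf1 hK hL
    hw hexp hεw' ht (by linarith)
  have hMfin : ∫⁻ n : ℕ, (n : ℝ≥0∞) ∂π < ∞ := lintegral_stationary_lt_top hπ (I.stable u)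
  have hstar : ∫⁻ ω, (queueStar I X u t ω : ℝ≥0∞) ∂P = ∫⁻ n : ℕ, (n : ℝ≥0∞) ∂π := by
    rw [queueStar_eq_optimalQueue]
    exact lintegral_optimalQueue (f := fun q => (q u).2) hX hM hπ hf2 t
  have hstar_meas : Measurable (queueStar I X u t) := by
    rw [queueStar_eq_optimalQueue]
    exact measurable_optimalQueue (fun i _ => hX i)
      ((measurable_of_countable fun q : Fin U → ℕ × ℕ => (q u).2).comp (hX .init))
  have hfin := ENNReal.add_lt_top.2 ⟨hMfin, ENNReal.ofReal_lt_top (r := 24 / I.eps u ^ 2 *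
    Real.log t * (6 * K * Real.log t ^ 2 / t) + t * (t * Real.exp (-(3 * Real.log t)) +
    t * Real.exp (-(3 * Real.log t))))⟩
  obtain ⟨hI1, hI2⟩ := integrable_natCast_of_lintegral_lt_top (measurable_queue hX u t)
    (hmain.trans_lt hfin)
  obtain ⟨hS1, hS2⟩ := integrable_natCast_of_lintegral_lt_top hstar_meas (hstar.trans_lt hMfin)
  refine ⟨hI1, hS1, ?_⟩
  rw [regret, integral_sub hI1 hS1, hI2, hS2, hstar]
  have hreal := ENNReal.toReal_mono hfin.ne hmain
  have hL0 : 0 ≤ Real.log t := by linarith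
  rw [ENNReal.toReal_add hMfin.ne ENNReal.ofReal_ne_top,
    ENNReal.toReal_ofReal (by positivity)] at hreal
  -- the exceptional events contribute `2 / t`, which the main term dominates
  have hexp3 : (t : ℝ) * (t * Real.exp (-(3 * Real.log t))) = 1 / t := by
    rw [Real.exp_neg, show 3 * Real.log t = ((3 : ℕ) : ℝ) * Real.log t by norm_num,
      Real.exp_nat_mul, Real.exp_log ht0]
    field_simp
  generalize v K Δ (I.eps u) t = V at *
  generalize Real.log t = L at *
  have hone : (1 : ℝ) ≤ K * V * L ^ 2 := by
    have h1 : 1 ≤ V := by linarith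
    have h2 : 1 ≤ L ^ 2 := by nlinarith
    have h3 : 1 ≤ (K : ℝ) * V := by nlinarith
    exact one_le_mul_of_one_le_of_one_le h3 h2
  have h1 : 1 / (t : ℝ) ≤ K * V * L ^ 2 / t := by gcongr
  have h2 : 24 / I.eps u ^ 2 * L * (6 * K * L ^ 2 / t) ≤ 6 * (K * V * L ^ 2 / t) := by
    calc 24 / I.eps u ^ 2 * L * (6 * K * L ^ 2 / t) ≤ V * (6 * K * L ^ 2 / t) :=
          mul_le_mul_of_nonneg_right hv0 (by positivity)
      _ = _ := by ring
  rw [mul_add (t : ℝ), hexp3] at hreal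
  linarith

end Regret

end QueueingBandit

theorem mainTheorem1 (Δ : ℝ) (hΔ : 0 < Δ) :
    ∃ C t₀ : ℝ, ∀ (U K : ℕ) [NeZero K], 2 ≤ K →
      ∀ I : QueueingBandit.Instance U K, I.gap = Δ →
      ∀ 𝓔 : Finset (QueueingBandit.Matching U K), QueueingBandit.IsExploreSet 𝓔 →
      ∀ proj : QueueingBandit.History U K → (Fin U → Fin K) → QueueingBandit.Matching U K,
        QueueingBandit.IsProjection proj →
      ∀ ν : Measure (Fin U → ℕ × ℕ), QueueingBandit.IsInitialLaw I ν →
      ∀ (Ω : Type*) [MeasurableSpace Ω] (P : Measure Ω) [IsProbabilityMeasure P]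
        (X : (i : QueueingBandit.Source U K) → Ω → i.Val), QueueingBandit.IsModel I 𝓔 ν P X →
      ∀ (u : Fin U) (t : ℕ), t₀ < t →
        2 / I.eps u ≤ QueueingBandit.w Δ t / Real.log t →
        Real.exp (6 / Δ ^ 2) ≤ t →
        QueueingBandit.v K Δ (I.eps u) t + QueueingBandit.v' K Δ (I.eps u) t ≤ (t : ℝ) / 2 →
        Integrable (fun ω => (QueueingBandit.queue proj X u t ω : ℝ)) P ∧
        Integrable (fun ω => (QueueingBandit.queueStar I X u t ω : ℝ)) P ∧
        QueueingBandit.regret proj X P I u t ≤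
          C * (K * QueueingBandit.v K Δ (I.eps u) t * Real.log t ^ 2 / t) := by
  obtain ⟨t₀, ht₀⟩ := QueueingBandit.eventually_growth hΔ
  refine ⟨8, t₀, fun U K _ hK I hI 𝓔 h𝓔 proj hproj ν hν Ω _ P _ X hM u t ht hεw _ hv => ?_⟩
  obtain ⟨hL, hw, hexp⟩ := ht₀ t ht
  have hgap : ∀ u k, k ≠ I.best u → Δ ≤ (I.mu u (I.best u) : ℝ) - I.mu u k :=
    fun u k hk => hI ▸ QueueingBandit.gap_le I u hk
  -- the gap is a difference of probabilities, and a suboptimal server exists as `2 ≤ K`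
  have hΔ1 : Δ ≤ 1 := by
    obtain ⟨k, hk⟩ : ∃ k, k ≠ I.best u := by
      have : Nontrivial (Fin K) := Fin.nontrivial_iff_two_le.2 hK
      exact exists_ne _
    have h1 := (I.mu u (I.best u)).2.2
    have h2 := (I.mu u k).2.1
    linarith [hgap u k hk]
  obtain ⟨Y, hY, hMY, hXY⟩ := hM.exists_measurable
  obtain ⟨h1, h2, h3⟩ := QueueingBandit.regret_le_of_measurable (proj := proj) hY hMY h𝓔 hproj hν
    hΔ hΔ1 hgap (u := u) hK hL hw hexp hεw hv
  have hQ : (fun ω => (QueueingBandit.queue proj X u t ω : ℝ)) =ᵐ[P]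
      fun ω => (QueueingBandit.queue proj Y u t ω : ℝ) := by
    filter_upwards [hXY] with ω hω
    rw [QueueingBandit.queue_congr hω]
  have hQ' : (fun ω => (QueueingBandit.queueStar I X u t ω : ℝ)) =ᵐ[P]
      fun ω => (QueueingBandit.queueStar I Y u t ω : ℝ) := by
    filter_upwards [hXY] with ω hω
    rw [QueueingBandit.queueStar_congr I hω]
  exact ⟨h1.congr hQ.symm, h2.congr hQ'.symm, (integral_congr_ae (hQ.sub hQ')).trans_le h3⟩
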